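/- **Theorem (Norm inequality for $A_\infty$ weights is characterized by the $L^\infty$ dual pairing testing condition).** Let $1<p\le q<\infty$ and let $q'=q/(q-1)$. Let $\sigma,\omega$ be locally finite Borel measures on $\mathbb{R}^d$, $d\ge 1$, and let $\mathcal{D}$ be a finite collection of dyadic cubes $2^{-k}([0,1)^d+j)$, $k\in\mathbb{Z}$, $j\in\mathbb{Z}^d$. Let $C$ and $D$ be Banach lattices, the dual $D^*$ being ordered by $\varphi\le\psi$ iff $\varphi(e)\le\psi(e)$ for all $e\ge0$. For a Banach lattice $E$ and $1<r<\infty$ let $\|\bar M\|_{L^r_E\to L^r_E}\in[0,\infty]$ be the supremum, over all finite collections $\mathcal{D}'$ of dyadic cubes in $\mathbb{R}^d$, of the norms on the Lebesgue--Bochner space $L^r_E(\mathbb{R}^d,dx)$ of the lattice maximal operators $$\bar M_{\mathcal{D}'}f=\sup_{Q\in\mathcal{D}'}\Big(\frac1{|Q|}\int_Q f\,dx\Big)1_Q ,$$ the supremum being taken in the order of $E$. The lattice $E$ has the dyadic Hardy--Littlewood property if $\|\bar M\|_{L^r_E\to L^r_E}<\infty$ for some $r\in(1,\infty)$. Assume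 that $C$ and $D^*$ each have the dyadic Hardy--Littlewood property. Let $\lambda_Q:C\to D$, $Q\in\mathcal{D}$, be positive linear operators and put, for $R\in\mathcal D$, $$T_\lambda(f\sigma)=\sum_{Q\in\mathcal{D}}\lambda_Q\Big(\int_Q f\,d\sigma\Big)1_Q,\qquad T_{R}(f\sigma)=\sum_{Q\in\mathcal{D},\,Q\subseteq R}\lambda_Q\Big(\int_Q f\,d\sigma\Big)1_Q .$$ Let $$[\sigma]_{A_\infty(\omega)}=\sup_{R\in\mathcal{D}}\frac1{\sigma(R)}\int\sup_{Q\in\mathcal{D},\,Q\subseteq R}\frac{\sigma(Q)}{\omega(Q)}1_Q\,d\omega ,$$ with $[\omega]_{A_\infty(\sigma)}$ defined symmetrically (and $0/0=0$), and assume that $\sigma$ and $\omega$ are each $A_\infty$ with respect to the other, that is, both characteristics are finite. Let $\mathfrak{B}$ be the least constant in $[0,\infty]$ such that $$\int g\,T_R(f\sigma)\,d\omega\le\mathfrak{B}\,\|f\|_{L^\infty_C(R,\sigma)}\|g\|_{L^\infty_{D^*}(R,\omega)}\,\sigma(R)^{1/p}\omega(R)^{1/q'}$$ for every $R\in\mathcal{D}$,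 $f\in L^\infty_C(R,\sigma)$ and $g\in L^\infty_{D^*}(R,\omega)$. Then $$\mathfrak{B}\le\|T_\lambda(\,\cdot\,\sigma)\|_{L^p_C(\sigma)\to L^q_D(\omega)}\le K\,\|\bar M\|_{L^p_C\to L^p_C}\,\|\bar M\|_{L^{q'}_{D^*}\to L^{q'}_{D^*}}\big([\sigma]_{A_\infty(\omega)}^{1/p}+[\omega]_{A_\infty(\sigma)}^{1/q'}\big)\,\mathfrak{B},$$ where $K<\infty$ depends only on $p$ and $q$. (Products in $[0,\infty]$ use $0\cdot\infty=0$.) -/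

import Mathlib

open MeasureTheory
open scoped ENNReal NNReal

noncomputable section

namespace DyadicTesting

set_option linter.unusedSectionVars false

/-! ### The order dual of a Banach lattice

Banach lattices are normed lattices `E` with `HasSolidNorm E`, `IsOrderedAddMonoid E`,
`IsOrderedModule ℝ E` and `CompleteSpace E`.  The dual is ordered by
`φ ≤ ψ ↔ ∀ c ≥ 0, φ c ≤ ψ c`; its lattice operations are given by the Riesz-Kantorovich formula. -/

section Dual

variable {E : Type*} [NormedAddCommGroup E] [Lattice E] [HasSolidNorm E] [IsOrderedAddMonoid E]
  [NormedSpace ℝ E]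

instance dualPartialOrder : PartialOrder (StrongDual ℝ E) where
  le φ ψ := ∀ c : E, 0 ≤ c → φ c ≤ ψ c
  le_refl φ c _ := le_rfl
  le_trans φ ψ χ h₁ h₂ c hc := (h₁ c hc).trans (h₂ c hc)
  le_antisymm φ ψ h₁ h₂ := by
    ext x
    have h : ∀ c : E, 0 ≤ c → φ c = ψ c := fun c hc => le_antisymm (h₁ c hc) (h₂ c hc)
    rw [← posPart_sub_negPart x, map_sub, map_sub, h _ (posPart_nonneg x), h _ (negPart_nonneg x)]

theorem dual_le_iff {φ ψ : StrongDual ℝ E} : φ ≤ ψ ↔ ∀ c : E, 0 ≤ c → φ c ≤ ψ c := Iff.rfl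

/-- The positive part of a functional on the positive cone: `sup {φ d : 0 ≤ d ≤ c}`. -/
def posPartFun (φ : StrongDual ℝ E) (c : E) : ℝ := sSup (φ '' Set.Icc 0 c)

theorem norm_le_of_mem_Icc {c d : E} (hd : d ∈ Set.Icc 0 c) : ‖d‖ ≤ ‖c‖ := by
  apply norm_le_norm_of_abs_le_abs
  rw [abs_of_nonneg hd.1, abs_of_nonneg (hd.1.trans hd.2)]
  exact hd.2

theorem apply_le_of_mem_Icc (φ : StrongDual ℝ E) {c d : E} (hd : d ∈ Set.Icc 0 c) :
    φ d ≤ ‖φ‖ * ‖c‖ :=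
  calc φ d ≤ ‖φ d‖ := Real.le_norm_self _
    _ ≤ ‖φ‖ * ‖d‖ := φ.le_opNorm d
    _ ≤ ‖φ‖ * ‖c‖ := mul_le_mul_of_nonneg_left (norm_le_of_mem_Icc hd) (norm_nonneg _)

theorem bddAbove_image (φ : StrongDual ℝ E) (c : E) : BddAbove (φ '' Set.Icc 0 c) := by
  refine ⟨‖φ‖ * ‖c‖, ?_⟩
  rintro _ ⟨d, hd, rfl⟩
  exact apply_le_of_mem_Icc φ hd

theorem le_posPartFun (φ : StrongDual ℝ E) {c d : E} (hd : d ∈ Set.Icc 0 c) :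
    φ d ≤ posPartFun φ c :=
  le_csSup (bddAbove_image φ c) ⟨d, hd, rfl⟩

theorem posPartFun_le (φ : StrongDual ℝ E) {c : E} (hc : 0 ≤ c) {b : ℝ}
    (h : ∀ d ∈ Set.Icc 0 c, φ d ≤ b) : posPartFun φ c ≤ b := by
  refine csSup_le ⟨_, 0, ⟨le_rfl, hc⟩, rfl⟩ ?_
  rintro _ ⟨d, hd, rfl⟩
  exact h d hd

theorem posPartFun_nonneg (φ : StrongDual ℝ E) {c : E} (hc : 0 ≤ c) : 0 ≤ posPartFun φ c := by
  simpa using le_posPartFun φ (d := 0) ⟨le_rfl, hc⟩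

theorem posPartFun_add (φ : StrongDual ℝ E) {a b : E} (ha : 0 ≤ a) (hb : 0 ≤ b) :
    posPartFun φ (a + b) = posPartFun φ a + posPartFun φ b := by
  apply le_antisymm
  · refine posPartFun_le φ (add_nonneg ha hb) fun d hd => ?_
    have h₁ : d ⊓ a ∈ Set.Icc 0 a := ⟨le_inf hd.1 ha, inf_le_right⟩
    have h₂ : d - d ⊓ a ∈ Set.Icc 0 b := by
      refine ⟨sub_nonneg.2 inf_le_left, ?_⟩
      rw [sub_le_iff_le_add, add_comm, ← sub_le_iff_le_add]
      exact le_inf (sub_le_self d hb) (sub_le_iff_le_add.2 hd.2)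
    calc φ d = φ (d ⊓ a) + φ (d - d ⊓ a) := by rw [← map_add]; congr 1; abel
      _ ≤ _ := add_le_add (le_posPartFun φ h₁) (le_posPartFun φ h₂)
  · rw [← le_sub_iff_add_le]
    refine posPartFun_le φ ha fun d hd => ?_
    rw [le_sub_iff_add_le, ← le_sub_iff_add_le']
    refine posPartFun_le φ hb fun e he => ?_
    rw [le_sub_iff_add_le', ← map_add]
    exact le_posPartFun φ ⟨add_nonneg hd.1 he.1, add_le_add hd.2 he.2⟩

/-- The additive extension of `posPartFun φ` from the positive cone to `E`. -/
def posPartHom (φ : StrongDual ℝ E) : E →+ ℝ :=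
  AddMonoidHom.mk' (fun x => posPartFun φ x⁺ - posPartFun φ x⁻) fun x y => by
    have key : (x + y)⁺ + (x⁻ + y⁻) = (x⁺ + y⁺) + (x + y)⁻ := by
      have h₁ := posPart_sub_negPart (x + y)
      have h₂ := posPart_sub_negPart x
      have h₃ := posPart_sub_negPart y
      have h₄ : (x + y)⁺ - (x + y)⁻ = (x⁺ - x⁻) + (y⁺ - y⁻) := by rw [h₁, h₂, h₃]
      rw [sub_eq_iff_eq_add] at h₄
      rw [h₄]
      abel
    have h := congrArg (posPartFun φ) key
    rw [posPartFun_add φ (posPart_nonneg _) (add_nonneg (negPart_nonneg _) (negPart_nonneg _)),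
      posPartFun_add φ (negPart_nonneg _) (negPart_nonneg _),
      posPartFun_add φ (add_nonneg (posPart_nonneg _) (posPart_nonneg _)) (negPart_nonneg _),
      posPartFun_add φ (posPart_nonneg _) (posPart_nonneg _)] at h
    linarith

theorem posPartHom_apply (φ : StrongDual ℝ E) (x : E) :
    posPartHom φ x = posPartFun φ x⁺ - posPartFun φ x⁻ := rfl

theorem posPartHom_bound (φ : StrongDual ℝ E) (x : E) : ‖posPartHom φ x‖ ≤ ‖φ‖ * ‖x‖ := by
  have h : ∀ c : E, 0 ≤ c → c ≤ |x| → posPartFun φ c ≤ ‖φ‖ * ‖x‖ := fun c hc hcx =>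
    posPartFun_le φ hc fun d hd => by
      rw [← norm_abs_eq_norm x]
      exact apply_le_of_mem_Icc φ ⟨hd.1, hd.2.trans hcx⟩
  have hp := h x⁺ (posPart_nonneg x) (sup_le (le_abs_self x) (abs_nonneg x))
  have hn := h x⁻ (negPart_nonneg x) (sup_le (neg_le_abs x) (abs_nonneg x))
  have hp' := posPartFun_nonneg φ (posPart_nonneg x)
  have hn' := posPartFun_nonneg φ (negPart_nonneg x)
  rw [posPartHom_apply, Real.norm_eq_abs, abs_le]
  constructor <;> linarith

/-- The positive part `φ ∨ 0` of a functional. -/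
def dualPosPart (φ : StrongDual ℝ E) : StrongDual ℝ E :=
  (posPartHom φ).toRealLinearMap
    (AddMonoidHomClass.continuous_of_bound (posPartHom φ) ‖φ‖ (posPartHom_bound φ))

theorem dualPosPart_apply (φ : StrongDual ℝ E) {c : E} (hc : 0 ≤ c) :
    dualPosPart φ c = posPartFun φ c := by
  have h₀ : posPartFun φ (0 : E) = 0 :=
    le_antisymm (posPartFun_le φ le_rfl fun d hd => by
      rw [le_antisymm hd.2 hd.1, map_zero]) (posPartFun_nonneg φ le_rfl)
  change posPartFun φ c⁺ - posPartFun φ c⁻ = _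
  rw [posPart_eq_self.2 hc, negPart_eq_zero.2 hc, h₀, sub_zero]

theorem le_dualPosPart (φ : StrongDual ℝ E) : φ ≤ dualPosPart φ := fun c hc => by
  rw [dualPosPart_apply φ hc]
  exact le_posPartFun φ ⟨hc, le_rfl⟩

theorem dualPosPart_nonneg (φ : StrongDual ℝ E) : 0 ≤ dualPosPart φ := fun c hc => by
  rw [dualPosPart_apply φ hc]
  exact posPartFun_nonneg φ hc

theorem dualPosPart_le {φ ψ : StrongDual ℝ E} (h : φ ≤ ψ) (h₀ : 0 ≤ ψ) : dualPosPart φ ≤ ψ :=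
  fun c hc => by
    rw [dualPosPart_apply φ hc]
    refine posPartFun_le φ hc fun d hd => (h d hd.1).trans ?_
    have h₁ : 0 ≤ ψ (c - d) := h₀ (c - d) (sub_nonneg.2 hd.2)
    rw [map_sub] at h₁
    exact sub_nonneg.1 h₁

instance dualLattice : Lattice (StrongDual ℝ E) where
  sup φ ψ := ψ + dualPosPart (φ - ψ)
  le_sup_left φ ψ c hc := by
    have := le_dualPosPart (φ - ψ) c hc
    simp only [sub_apply, add_apply] at this ⊢
    linarith
  le_sup_right φ ψ c hc := by
    have := dualPosPart_nonneg (φ - ψ) c hc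
    simp only [zero_apply, add_apply] at this ⊢
    linarith
  sup_le φ ψ χ h₁ h₂ c hc := by
    have h : dualPosPart (φ - ψ) ≤ χ - ψ := dualPosPart_le
      (fun d hd => by have := h₁ d hd; simp only [sub_apply]; linarith)
      (fun d hd => by
        have := h₂ d hd
        simp only [sub_apply, zero_apply]; linarith)
    have := h c hc
    simp only [sub_apply, add_apply] at this ⊢
    linarith
  inf φ ψ := φ - dualPosPart (φ - ψ)
  inf_le_left φ ψ c hc := by
    have := dualPosPart_nonneg (φ - ψ) c hc
    simp only [zero_apply, sub_apply] at this ⊢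
    linarith
  inf_le_right φ ψ c hc := by
    have := le_dualPosPart (φ - ψ) c hc
    simp only [sub_apply] at this ⊢
    linarith
  le_inf χ φ ψ h₁ h₂ c hc := by
    have h : dualPosPart (φ - ψ) ≤ φ - χ := dualPosPart_le
      (fun d hd => by have := h₂ d hd; simp only [sub_apply]; linarith)
      (fun d hd => by
        have := h₁ d hd
        simp only [sub_apply, zero_apply]; linarith)
    have := h c hc
    simp only [sub_apply] at this ⊢
    linarith

end Dual

/-! ### Dyadic cubes -/

/-- An index for the dyadic cube `2 ^ (-scale) * ([0, 1) ^ d + corner)`. -/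
structure DyadicCube (d : ℕ) where
  scale : ℤ
  corner : Fin d → ℤ

/-- The half-open dyadic cube as a subset of `ℝ ^ d`. -/
def DyadicCube.toSet {d : ℕ} (Q : DyadicCube d) : Set (Fin d → ℝ) :=
  {x | ∀ i, (2 : ℝ) ^ (-Q.scale) * (Q.corner i : ℝ) ≤ x i ∧
    x i < (2 : ℝ) ^ (-Q.scale) * ((Q.corner i : ℝ) + 1)}

open Classical in
/-- The cubes of the collection `𝒟` that are contained in the cube `R`. -/
def subcubes {d : ℕ} (𝒟 : Finset (DyadicCube d)) (R : DyadicCube d) : Finset (DyadicCube d) :=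
  𝒟.filter fun Q => Q.toSet ⊆ R.toSet

/-! ### The lattice maximal operator and the Hardy-Littlewood property -/

section Maximal

variable {d : ℕ} {E : Type*} [NormedAddCommGroup E] [NormedSpace ℝ E] [Lattice E]

/-- The dyadic lattice maximal function `sup_{Q ∈ 𝒟} ⟨f⟩_Q 1_Q` (Lebesgue averages, supremum in the
lattice order), with value `0` for the empty collection. -/
def latticeMaximal (𝒟 : Finset (DyadicCube d)) (f : (Fin d → ℝ) → E) (x : Fin d → ℝ) : E :=
  open Classical in
  if h : 𝒟.Nonempty then
    𝒟.sup' h fun Q => Q.toSet.indicator (fun _ => ⨍ y in Q.toSet, f y ∂volume) x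
  else 0

variable (d E) in
/-- The uniform norm of the lattice maximal operators on `L^p_E(ℝ^d)`: the least constant `K` such
that `‖M̄_𝒟 f‖ ≤ K ‖f‖` for all finite collections `𝒟` of dyadic cubes and all `f ∈ L^p_E`. -/
def maximalNorm (p : ℝ) : ℝ≥0∞ :=
  sInf {K : ℝ≥0∞ | ∀ (𝒟 : Finset (DyadicCube d)) (f : (Fin d → ℝ) → E),
    MemLp f (ENNReal.ofReal p) volume →
    eLpNorm (latticeMaximal 𝒟 f) (ENNReal.ofReal p) volume
      ≤ K * eLpNorm f (ENNReal.ofReal p) volume}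

variable (d E) in
/-- The dyadic Hardy-Littlewood property. -/
def HardyLittlewoodProperty : Prop :=
  ∃ r : ℝ, 1 < r ∧ maximalNorm d E r < ∞

end Maximal

/-! ### The dyadic operator, its norm, and the testing constant -/

section Operator

variable {d : ℕ} {C D : Type*} [NormedAddCommGroup C] [NormedSpace ℝ C] [NormedAddCommGroup D]
  [NormedSpace ℝ D]

/-- `T_λ(fσ) = ∑_{Q ∈ 𝒟} λ_Q (∫_Q f dσ) 1_Q`. -/
def dyadicOp (𝒟 : Finset (DyadicCube d)) (lam : DyadicCube d → C →ₗ[ℝ] D)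
    (σ : Measure (Fin d → ℝ)) (f : (Fin d → ℝ) → C) (x : Fin d → ℝ) : D :=
  ∑ Q ∈ 𝒟, Q.toSet.indicator (fun _ => lam Q (∫ y in Q.toSet, f y ∂σ)) x

/-- The norm of `T_λ(·σ) : L^p_C(σ) → L^q_D(ω)`: the least constant in the norm inequality. -/
def dyadicOpNorm (p q : ℝ) (𝒟 : Finset (DyadicCube d)) (lam : DyadicCube d → C →ₗ[ℝ] D)
    (σ ω : Measure (Fin d → ℝ)) : ℝ≥0∞ :=
  sInf {K : ℝ≥0∞ | ∀ f : (Fin d → ℝ) → C, MemLp f (ENNReal.ofReal p) σ →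
    eLpNorm (dyadicOp 𝒟 lam σ f) (ENNReal.ofReal q) ω ≤ K * eLpNorm f (ENNReal.ofReal p) σ}

/-- The least constant `𝔅` in the `L^∞` dual pairing testing condition
`∫ g T_R(fσ) dω ≤ 𝔅 ‖f‖_{L^∞_C(R,σ)} ‖g‖_{L^∞_{D*}(R,ω)} σ(R)^{1/p} ω(R)^{1/q'}`, `R ∈ 𝒟`. -/
def dualPairingTestingConst (p q : ℝ) (𝒟 : Finset (DyadicCube d))
    (lam : DyadicCube d → C →ₗ[ℝ] D) (σ ω : Measure (Fin d → ℝ)) : ℝ≥0∞ :=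
  sInf {B : ℝ≥0∞ | ∀ R ∈ 𝒟, ∀ (f : (Fin d → ℝ) → C) (g : (Fin d → ℝ) → StrongDual ℝ D),
    MemLp f ∞ (σ.restrict R.toSet) → MemLp g ∞ (ω.restrict R.toSet) →
    ENNReal.ofReal (∫ x, g x (dyadicOp (subcubes 𝒟 R) lam σ f x) ∂ω)
      ≤ B * eLpNorm f ∞ (σ.restrict R.toSet) * eLpNorm g ∞ (ω.restrict R.toSet)
        * σ R.toSet ^ (1 / p) * ω R.toSet ^ (1 / q.conjExponent)}

end Operator

/-! ### The `A_∞` characteristic -/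

/-- The localized maximal function `sup_{Q ∈ 𝒟, Q ⊆ R} (σ(Q) / ω(Q)) 1_Q`. -/
def localMaximal {d : ℕ} (𝒟 : Finset (DyadicCube d)) (R : DyadicCube d)
    (σ ω : Measure (Fin d → ℝ)) (x : Fin d → ℝ) : ℝ≥0∞ :=
  ⨆ Q ∈ subcubes 𝒟 R, Q.toSet.indicator (fun _ => σ Q.toSet / ω Q.toSet) x

/-- The characteristic `[σ]_{A_∞(ω)} = sup_{R ∈ 𝒟} σ(R)⁻¹ ∫ M_R^ω(σ) dω`. -/
def aInfty {d : ℕ} (𝒟 : Finset (DyadicCube d)) (σ ω : Measure (Fin d → ℝ)) : ℝ≥0∞ :=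
  ⨆ R ∈ 𝒟, (∫⁻ x, localMaximal 𝒟 R σ ω x ∂ω) / σ R.toSet

end DyadicTesting

end

/-!
The norm of `T_λ` is controlled by duality through the positive bilinear form
`∑_Q ⟨∫_Q g dω, λ_Q (∫_Q f dσ)⟩` with `f, g ≥ 0`, which involves `f` and `g` only through their
integrals over the cubes.

To a cube `Q` one attaches the norm `m_Q` of the lattice supremum of the averages `⟨f⟩_R`, `R ⊇ Q`
(`runningSup`), and likewise `n_Q` for `g`.  For a threshold `t` the lattice supremum of the averages
over the cubes with `m_Q ≤ t` (`truncatedSup`) has norm at most `t` at every point, and its integral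
dominates that of `f` over each such cube.  Hence the testing condition bounds the part of the form
in which `Q ⊆ R`, `m_Q ≤ u` and `n_Q ≤ v` by `𝔅 u v σ(R)^{1/p} ω(R)^{1/q'}`, and what is left is a
statement about the numbers `m_Q`, `n_Q` (`sum_le_of_local_bound`).

It is proved with parallel stopping families.  The level of a stopping cube `F` is a *median* over
`F`, with respect to `σ`, of `h(x) = max_{Q ∋ x} m_Q`, and one stops as soon as `m_Q` exceeds twice
the level (`nonempty_stoppingFamily`).  Since the level is a median, the next stopping cubes cover at
most half of `F`, so the family is sparse, and `h` is at least the level on half of `F`.  Since the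
levels double along chains of stopping cubes, the sum of `level(F)^p σ(F)` is then at most
`4 ∫ h^p dσ`; no maximal inequality is used for this Carleson embedding.  Sparseness and the `A_∞`
condition make the family a Carleson family for the other measure, and Hölder's inequality with
`1/p + 1/q' ≥ 1` sums the local estimates (`sum_le_of_proj_subset`).

Finally `∫ h^p dσ` has to be bounded by the maximal operator of Lebesgue measure, with a constant that
does not depend on the dimension (`lintegral_maxOver_runningSup_le`).  A finite martingale over `σ` is
copied into Lebesgue measure: a step that splits a set in the proportions `t : 1 - t` is imitated by
dividing a dyadic cube into many small dyadic cubes and assigning a proportion close to `t` of them to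
the first piece and close to `1 - t` to the second (`realizable_mix`).  The remaining small cubes
carry the value `0`, and by positivity only a factor close to `1` is lost.
-/

namespace DyadicTesting

set_option linter.unusedSectionVars false

/-! ### The dual of a Banach lattice is a Banach lattice -/

section DualLattice

variable {E : Type*} [NormedAddCommGroup E] [Lattice E] [HasSolidNorm E] [IsOrderedAddMonoid E]
  [NormedSpace ℝ E]

instance : IsOrderedAddMonoid (StrongDual ℝ E) where
  add_le_add_left φ ψ h χ c hc := by
    have := h c hc
    simp only [add_apply]
    linarith

instance : IsOrderedModule ℝ (StrongDual ℝ E) where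
  smul_le_smul_of_nonneg_left a ha φ ψ h c hc := by
    have := mul_le_mul_of_nonneg_left (h c hc) ha
    simpa using this
  smul_le_smul_of_nonneg_right φ h a b hab c hc := by
    have := mul_le_mul_of_nonneg_right hab (h c hc)
    simpa using this

theorem abs_apply_le_abs_dual (φ : StrongDual ℝ E) (x : E) : |φ x| ≤ |φ| |x| := by
  have h : ∀ c : E, 0 ≤ c → |φ c| ≤ |φ| c := fun c hc => by
    have h₁ := le_abs_self φ c hc
    have h₂ := neg_le_abs φ c hc
    simp only [neg_apply] at h₂
    exact abs_le'.2 ⟨h₁, h₂⟩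
  calc |φ x| = |φ x⁺ - φ x⁻| := by rw [← map_sub, posPart_sub_negPart]
    _ ≤ |φ x⁺| + |φ x⁻| := abs_sub _ _
    _ ≤ |φ| x⁺ + |φ| x⁻ := add_le_add (h _ (posPart_nonneg x)) (h _ (negPart_nonneg x))
    _ = |φ| |x| := by rw [← map_add, posPart_add_negPart]

theorem abs_dual_apply_le (φ : StrongDual ℝ E) {c : E} (hc : 0 ≤ c) : |φ| c ≤ ‖φ‖ * ‖c‖ := by
  have h : |φ| c = -φ c + posPartFun (φ - -φ) c := by
    rw [← dualPosPart_apply _ hc]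
    rfl
  rw [h, ← le_sub_iff_add_le']
  refine posPartFun_le _ hc fun d hd => ?_
  -- On the order interval `[0, c]` one has `|2 d - c| ≤ c`.
  have h₁ : ‖d + d - c‖ ≤ ‖c‖ := by
    apply norm_le_norm_of_abs_le_abs
    rw [abs_of_nonneg hc, abs_le']
    constructor
    · rw [sub_le_iff_le_add]
      exact add_le_add hd.2 hd.2
    · rw [neg_sub, sub_le_self_iff]
      exact add_nonneg hd.1 hd.1
  have h₂ : φ (d + d - c) ≤ ‖φ‖ * ‖c‖ :=
    (Real.le_norm_self _).trans ((φ.le_opNorm _).trans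
      (mul_le_mul_of_nonneg_left h₁ (norm_nonneg _)))
  simp only [map_sub, map_add, sub_apply, neg_apply] at h₂ ⊢
  linarith

instance : HasSolidNorm (StrongDual ℝ E) where
  solid φ ψ h := by
    refine φ.opNorm_le_bound (norm_nonneg _) fun x => ?_
    calc ‖φ x‖ ≤ |φ| |x| := abs_apply_le_abs_dual φ x
      _ ≤ |ψ| |x| := h _ (abs_nonneg x)
      _ ≤ ‖ψ‖ * ‖|x|‖ := abs_dual_apply_le ψ (abs_nonneg x)
      _ = ‖ψ‖ * ‖x‖ := by rw [norm_abs_eq_norm]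

/-- Every nonnegative vector has a norming functional that is nonnegative. -/
theorem exists_nonneg_dual_vector {y : E} (hy : 0 ≤ y) :
    ∃ φ : StrongDual ℝ E, 0 ≤ φ ∧ ‖φ‖ ≤ 1 ∧ ‖y‖ ≤ φ y := by
  obtain ⟨φ, h₁, h₂⟩ := exists_dual_vector'' ℝ y
  refine ⟨|φ|, abs_nonneg φ, by rwa [norm_abs_eq_norm], ?_⟩
  have h₃ := le_abs_self φ y hy
  rw [h₂] at h₃
  exact h₃

end DualLattice

/-! ### Suprema of finitely many positive vectors -/

section PosSup

variable {ι E : Type*} [Lattice E] [AddCommGroup E]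

/-- The supremum of `0` and the values of `v` on the finite set `s`.  For nonnegative `v` this is the
supremum of `v` over `s` with value `0` for the empty family. -/
def posSup (s : Finset ι) (v : ι → E) : E := s.fold (· ⊔ ·) 0 v

theorem posSup_empty (v : ι → E) : posSup ∅ v = 0 := rfl

theorem posSup_insert [DecidableEq ι] (i : ι) (s : Finset ι) (v : ι → E) :
    posSup (insert i s) v = v i ⊔ posSup s v :=
  Finset.fold_insert_idem

theorem posSup_nonneg (s : Finset ι) (v : ι → E) : 0 ≤ posSup s v := by
  classical
  induction s using Finset.induction_on with
  | empty => exact le_rfl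
  | insert i s _ ih => rw [posSup_insert]; exact ih.trans le_sup_right

theorem le_posSup {s : Finset ι} (v : ι → E) {i : ι} (hi : i ∈ s) : v i ≤ posSup s v := by
  classical
  rw [← Finset.insert_eq_of_mem hi, posSup_insert]
  exact le_sup_left

theorem posSup_le {s : Finset ι} {v : ι → E} {b : E} (hb : 0 ≤ b) (h : ∀ i ∈ s, v i ≤ b) :
    posSup s v ≤ b := by
  classical
  induction s using Finset.induction_on with
  | empty => exact hb
  | insert i s _ ih =>
    rw [posSup_insert]
    exact sup_le (h i (Finset.mem_insert_self i s))
      (ih fun j hj => h j (Finset.mem_insert_of_mem hj))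

end PosSup

theorem enorm_mono_of_nonneg {E : Type*} [NormedAddCommGroup E] [Lattice E] [HasSolidNorm E]
    [IsOrderedAddMonoid E] {a b : E} (ha : 0 ≤ a) (hab : a ≤ b) : ‖a‖ₑ ≤ ‖b‖ₑ := by
  have h : ‖a‖ ≤ ‖b‖ := norm_le_norm_of_abs_le_abs (by
    rw [abs_of_nonneg ha, abs_of_nonneg (ha.trans hab)]; exact hab)
  exact enorm_le_iff_norm_le.2 h

/-! ### Functions of the membership pattern -/

section Pattern

variable {X ι : Type*} [MeasurableSpace X]

open Classical in
/-- The simple function that maps `x` to the set of those `i ∈ 𝒟` with `x ∈ s i`. -/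
noncomputable def pattern (𝒟 : Finset ι) (s : ι → Set X) (hs : ∀ i ∈ 𝒟, MeasurableSet (s i)) :
    SimpleFunc X (Finset ι) where
  toFun x := 𝒟.filter fun i => x ∈ s i
  measurableSet_fiber' t := by
    by_cases ht : t ⊆ 𝒟
    · have : (fun x => 𝒟.filter fun i => x ∈ s i) ⁻¹' {t}
          = ⋂ i ∈ 𝒟, if i ∈ t then s i else (s i)ᶜ := by
        ext x
        simp only [Set.mem_preimage, Set.mem_singleton_iff, Set.mem_iInter]
        constructor
        · rintro rfl i hi
          by_cases hx : x ∈ s i <;> simp [hx, hi]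
        · intro h
          ext i
          simp only [Finset.mem_filter]
          constructor
          · rintro ⟨hi, hx⟩
            by_contra hit
            have := h i hi
            simp only [hit, if_false] at this
            exact this hx
          · intro hit
            have := h i (ht hit)
            simp only [hit, if_true] at this
            exact ⟨ht hit, this⟩
      rw [this]
      refine Finset.measurableSet_biInter _ fun i hi => ?_
      split_ifs
      · exact hs i hi
      · exact (hs i hi).compl
    · convert MeasurableSet.empty
      rw [Set.eq_empty_iff_forall_notMem]
      rintro x rfl
      exact ht (Finset.filter_subset _ _)
  finite_range' := (𝒟.powerset.finite_toSet).subset <| by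
    rintro _ ⟨x, rfl⟩
    exact Finset.mem_coe.2 (Finset.mem_powerset.2 (Finset.filter_subset _ _))

end Pattern

/-! ### Two elementary inequalities for sums -/

/-- Hölder's inequality for exponents with `1 ≤ 1 / p + 1 / r`, which holds for sums because the
`ℓ^r` norms decrease in `r`. -/
theorem sum_mul_le_rpow_mul_rpow {ι : Type*} (S : Finset ι) (x y : ι → ℝ≥0∞) {p r : ℝ}
    (hp : 1 < p) (hr : 1 < r) (hpr : 1 ≤ 1 / p + 1 / r) :
    ∑ i ∈ S, x i * y i ≤ (∑ i ∈ S, x i ^ p) ^ (1 / p) * (∑ i ∈ S, y i ^ r) ^ (1 / r) := by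
  have hc := Real.HolderConjugate.conjExponent hp
  set p' := p.conjExponent
  have hr0 : 0 < r := by linarith
  have hrp : r ≤ p' := by
    have h₁ := hc.inv_add_inv_eq_one
    have h₂ : p'⁻¹ ≤ r⁻¹ := by
      rw [one_div, one_div] at hpr
      linarith
    exact (inv_le_inv₀ hc.symm.pos hr0).1 h₂
  refine (ENNReal.inner_le_Lp_mul_Lq S x y hc).trans (mul_le_mul_right ?_ _)
  -- It remains to see that the `ℓ^p'` norm of `y` is at most its `ℓ^r` norm.
  set Y := (∑ i ∈ S, y i ^ r) ^ (1 / r) with hY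
  have hYr : Y ^ r = ∑ i ∈ S, y i ^ r := by
    rw [hY, ← ENNReal.rpow_mul, one_div_mul_cancel hr0.ne', ENNReal.rpow_one]
  have hyY : ∀ i ∈ S, y i ≤ Y := fun i hi => by
    rw [← ENNReal.rpow_le_rpow_iff hr0, hYr]
    exact Finset.single_le_sum (f := fun i => y i ^ r) (fun _ _ => zero_le) hi
  have hsum : ∑ i ∈ S, y i ^ p' ≤ Y ^ p' := by
    have hs : p' = r + (p' - r) := by ring
    calc ∑ i ∈ S, y i ^ p' ≤ ∑ i ∈ S, y i ^ r * Y ^ (p' - r) := by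
          refine Finset.sum_le_sum fun i hi => ?_
          conv_lhs => rw [hs]
          rw [ENNReal.rpow_add_of_nonneg _ _ hr0.le (sub_nonneg.2 hrp)]
          exact mul_le_mul_right (ENNReal.rpow_le_rpow (hyY i hi) (sub_nonneg.2 hrp)) _
      _ = Y ^ p' := by
          rw [← Finset.sum_mul, ← hYr, ← ENNReal.rpow_add_of_nonneg _ _ hr0.le (sub_nonneg.2 hrp),
            ← hs]
  calc (∑ i ∈ S, y i ^ p') ^ (1 / p') ≤ (Y ^ p') ^ (1 / p') :=
        ENNReal.rpow_le_rpow hsum (by have := hc.symm.pos; positivity)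
    _ = Y := by
        rw [← ENNReal.rpow_mul, mul_one_div_cancel hc.symm.pos.ne', ENNReal.rpow_one]

/-- A family of numbers in which, of any two, one is more than twice the other is summed by its
largest member. -/
theorem sum_rpow_le_of_doubling {ι : Type*} [DecidableEq ι] (S : Finset ι) (φ : ι → ℝ≥0) {p : ℝ}
    (hp : 1 ≤ p) (hφ : ∀ i ∈ S, ∀ j ∈ S, i ≠ j → 2 * φ i < φ j ∨ 2 * φ j < φ i) :
    ∀ b : ℝ≥0, (∀ i ∈ S, φ i ≤ b) → ∑ i ∈ S, φ i ^ p ≤ 2 * b ^ p := by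
  have hp0 : 0 ≤ p := by linarith
  induction S using Finset.induction_on_max_value φ with
  | empty => simp
  | insert i S hi hmax ih =>
    intro b hb
    have h₁ : ∑ j ∈ S, φ j ^ p ≤ 2 * (φ i / 2) ^ p := by
      refine ih (fun j hj k hk => hφ j (Finset.mem_insert_of_mem hj) k
        (Finset.mem_insert_of_mem hk)) _ fun j hj => ?_
      have hji : j ≠ i := fun h => hi (h ▸ hj)
      rw [le_div_iff₀ two_pos, mul_comm]
      rcases hφ j (Finset.mem_insert_of_mem hj) i (Finset.mem_insert_self i S) hji with h | h
      · exact h.le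
      · exact absurd h (not_lt.2 ((hmax j hj).trans (by
          rw [two_mul]; exact le_add_of_nonneg_left zero_le)))
    have h₂ : 2 * (φ i / 2) ^ p ≤ φ i ^ p := by
      rw [NNReal.div_rpow, ← mul_div_assoc, div_le_iff₀ (NNReal.rpow_pos two_pos), mul_comm]
      refine mul_le_mul_right ?_ _
      calc (2 : ℝ≥0) = 2 ^ (1 : ℝ) := (NNReal.rpow_one 2).symm
        _ ≤ 2 ^ p := NNReal.rpow_le_rpow_of_exponent_le one_le_two hp
    have h₃ : φ i ^ p ≤ b ^ p := NNReal.rpow_le_rpow (hb i (Finset.mem_insert_self i S)) hp0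
    rw [Finset.sum_insert hi, two_mul]
    exact add_le_add h₃ ((h₁.trans h₂).trans h₃)

/-! ### Stopping families in a finite laminar family of sets -/

section Stopping

variable {X ι : Type*}

/-- A finite family of measurable sets, indexed without repetition, any two of which are nested or
disjoint. -/
structure IsLaminar [MeasurableSpace X] (𝒟 : Finset ι) (s : ι → Set X) : Prop where
  measurableSet : ∀ Q ∈ 𝒟, MeasurableSet (s Q)
  injOn : Set.InjOn s 𝒟
  nested : ∀ Q ∈ 𝒟, ∀ R ∈ 𝒟, s Q ⊆ s R ∨ s R ⊆ s Q ∨ Disjoint (s Q) (s R)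

open Classical in
/-- The function `x ↦ max {m Q : Q ∈ 𝒟, x ∈ s Q}`. -/
noncomputable def maxOver (𝒟 : Finset ι) (s : ι → Set X) (m : ι → ℝ≥0) (x : X) : ℝ≥0 :=
  (𝒟.filter fun Q => x ∈ s Q).sup m

theorem le_maxOver {𝒟 : Finset ι} {s : ι → Set X} (m : ι → ℝ≥0) {Q : ι} {x : X} (hQ : Q ∈ 𝒟)
    (hx : x ∈ s Q) : m Q ≤ maxOver 𝒟 s m x := by
  classical
  exact Finset.le_sup (f := m) (Finset.mem_filter.2 ⟨hQ, hx⟩)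

theorem measurable_maxOver [MeasurableSpace X] {𝒟 : Finset ι} {s : ι → Set X} (hs : ∀ Q ∈ 𝒟, MeasurableSet (s Q))
    (m : ι → ℝ≥0) : Measurable (maxOver 𝒟 s m) :=
  ((pattern 𝒟 s hs).map (Finset.sup · m)).measurable

/-- Medians of finitely valued functions exist. -/
theorem exists_median [MeasurableSpace X] (μ : Measure X) (h : X → ℝ≥0) (hh : (Set.range h).Finite) :
    ∃ t : ℝ≥0, μ {x | t < h x} ≤ μ Set.univ / 2 ∧ μ Set.univ / 2 ≤ μ {x | t ≤ h x} := by
  classical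
  set V : Finset ℝ≥0 := insert 0 hh.toFinset
  have hV : ∀ x, h x ∈ V := fun x =>
    Finset.mem_insert_of_mem (hh.mem_toFinset.2 (Set.mem_range_self x))
  have hVne : V.Nonempty := Finset.insert_nonempty _ _
  set A := V.filter fun t => μ {x | t < h x} ≤ μ Set.univ / 2
  have hA : A.Nonempty := by
    refine ⟨V.max' hVne, Finset.mem_filter.2 ⟨V.max'_mem hVne, ?_⟩⟩
    have : {x | V.max' hVne < h x} = ∅ := by
      ext x
      simpa only [Set.mem_ofPred_eq, Set.mem_empty_iff_false, iff_false, not_lt] using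
        V.le_max' _ (hV x)
    rw [this, measure_empty]
    exact zero_le
  set t := A.min' hA
  have ht := Finset.mem_filter.1 (A.min'_mem hA)
  refine ⟨t, ht.2, ?_⟩
  set W := V.filter fun v => v < t
  rcases W.eq_empty_or_nonempty with hW | hW
  · have : {x | t ≤ h x} = Set.univ := by
      ext x
      simp only [Set.mem_ofPred_eq, Set.mem_univ, iff_true]
      by_contra hx
      have : h x ∈ W := Finset.mem_filter.2 ⟨hV x, not_le.1 hx⟩
      simp [hW] at this
    rw [this]
    exact ENNReal.half_le_self
  -- Below `t`, the largest value `t'` has `{t ≤ h} = {t' < h}` and fails the defining condition.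
  · set t' := W.max' hW
    have ht' := Finset.mem_filter.1 (W.max'_mem hW)
    have : {x | t ≤ h x} = {x | t' < h x} := by
      ext x
      simp only [Set.mem_ofPred_eq]
      constructor
      · exact fun hx => ht'.2.trans_le hx
      · intro hx
        by_contra hx'
        exact absurd (W.le_max' _ (Finset.mem_filter.2 ⟨hV x, not_le.1 hx'⟩)) (not_le.2 hx)
    rw [this]
    by_contra hlt
    exact absurd (A.min'_le t' (Finset.mem_filter.2 ⟨ht'.1, (not_le.1 hlt).le⟩)) (not_le.2 ht'.2)

/-- The recursive selection of stopping sets, from the large sets down: `Q` is selected if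
`2 φ F < m Q` for every selected `F` strictly larger than `Q`. -/
theorem exists_stopping_selection (s : ι → Set X) (m φ : ι → ℝ≥0) (𝒟 : Finset ι) :
    ∃ S ⊆ 𝒟, ∀ Q ∈ 𝒟, Q ∈ S ↔ ∀ F ∈ S, s Q ⊂ s F → 2 * φ F < m Q := by
  classical
  induction 𝒟 using Finset.strongInduction with
  | H 𝒟 ih =>
    rcases 𝒟.eq_empty_or_nonempty with rfl | hne
    · exact ⟨∅, subset_rfl, by simp⟩
    obtain ⟨Q₀, hQ₀, hmin⟩ := 𝒟.finite_toSet.exists_minimalFor s _ hne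
    have hmin' : ∀ Q ∈ 𝒟, ¬ s Q ⊂ s Q₀ := fun Q hQ h => h.2 (hmin hQ h.1)
    obtain ⟨S, hS, hSQ⟩ := ih _ (Finset.erase_ssubset hQ₀)
    have hQS : Q₀ ∉ S := fun h => Finset.notMem_erase _ _ (hS h)
    by_cases hsel : ∀ F ∈ S, s Q₀ ⊂ s F → 2 * φ F < m Q₀
    · refine ⟨insert Q₀ S, Finset.insert_subset hQ₀ (hS.trans (Finset.erase_subset _ _)),
        fun Q hQ => ?_⟩
      by_cases hQQ : Q = Q₀
      · subst hQQ
        simp only [Finset.mem_insert_self, Finset.forall_mem_insert, true_iff]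
        exact ⟨fun h => absurd rfl h.ne, hsel⟩
      · rw [Finset.mem_insert, or_iff_right hQQ, hSQ Q (Finset.mem_erase.2 ⟨hQQ, hQ⟩),
          Finset.forall_mem_insert]
        exact ⟨fun h => ⟨fun h' => absurd h' (hmin' Q hQ), h⟩, fun h => h.2⟩
    · refine ⟨S, hS.trans (Finset.erase_subset _ _), fun Q hQ => ?_⟩
      by_cases hQQ : Q = Q₀
      · subst hQQ
        exact ⟨fun h => absurd h hQS, fun h => absurd h hsel⟩
      · exact hSQ Q (Finset.mem_erase.2 ⟨hQQ, hQ⟩)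

variable [MeasurableSpace X]

/-- A stopping family for the numbers `m Q`, `Q ∈ 𝒟`, with respect to the measure `μ`.
`level F` majorizes up to the factor `2` the numbers `m Q` for which `proj Q`, the least
stopping set that contains `Q`, is `F`; the levels satisfy a Carleson embedding, and the disjoint
sets `core F ⊆ F` witness sparseness. -/
structure StoppingFamily (μ : Measure X) (𝒟 : Finset ι) (s : ι → Set X) (m : ι → ℝ≥0) where
  carrier : Finset ι
  level : ι → ℝ≥0
  proj : ι → ι
  core : ι → Set X
  carrier_subset : carrier ⊆ 𝒟
  proj_mem : ∀ Q ∈ 𝒟, proj Q ∈ carrier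
  subset_proj : ∀ Q ∈ 𝒟, s Q ⊆ s (proj Q)
  proj_subset : ∀ Q ∈ 𝒟, ∀ F ∈ carrier, s Q ⊆ s F → s (proj Q) ⊆ s F
  le_level : ∀ Q ∈ 𝒟, m Q ≤ 2 * level (proj Q)
  sum_level_le : ∀ p : ℝ, 1 ≤ p → ∑ F ∈ carrier, (level F : ℝ≥0∞) ^ p * μ (s F)
    ≤ 4 * ∫⁻ x, (maxOver 𝒟 s m x : ℝ≥0∞) ^ p ∂μ
  measurableSet_core : ∀ F ∈ carrier, MeasurableSet (core F)
  core_subset : ∀ F ∈ carrier, core F ⊆ s F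
  core_disjoint : Set.PairwiseDisjoint (carrier : Set ι) core
  measure_le_core : ∀ F ∈ carrier, μ (s F) ≤ 2 * μ (core F)

/-- The level of `F` is a median over `F` of `h = maxOver 𝒟 s m`, and stopping occurs once `m`
exceeds twice the level.  The sets `F ∩ {h ≤ 2 level F}` are disjoint and at least half of `F`, and
`level F ≤ h` on at least half of `F`, while the levels double along any chain of stopping sets. -/
theorem nonempty_stoppingFamily (μ : Measure X) {𝒟 : Finset ι} {s : ι → Set X}
    (hD : IsLaminar 𝒟 s) (hpos : ∀ Q ∈ 𝒟, μ (s Q) ≠ 0) (hfin : ∀ Q ∈ 𝒟, μ (s Q) ≠ ∞)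
    (m : ι → ℝ≥0) :
    Nonempty (StoppingFamily μ 𝒟 s m) := by
  classical
  set h := maxOver 𝒟 s m with hh
  have hmeas : Measurable h := measurable_maxOver hD.measurableSet m
  have hrange : (Set.range h).Finite :=
    ((pattern 𝒟 s hD.measurableSet).map (Finset.sup · m)).finite_range
  have hmed : ∀ F : ι, ∃ t : ℝ≥0, μ.restrict (s F) {x | t < h x} ≤ μ (s F) / 2 ∧
      μ (s F) / 2 ≤ μ.restrict (s F) {x | t ≤ h x} := fun F => by
    simpa using exists_median (μ.restrict (s F)) h hrange
  choose φ hφ₁ hφ₂ using hmed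
  have hgt : ∀ t : ℝ≥0, MeasurableSet {x | t < h x} := fun t =>
    measurableSet_lt measurable_const hmeas
  have hge : ∀ t : ℝ≥0, MeasurableSet {x | t ≤ h x} := fun t =>
    measurableSet_le measurable_const hmeas
  have hφm : ∀ F ∈ 𝒟, m F ≤ φ F := fun F hF => by
    by_contra hlt
    have hsub : s F ⊆ {x | φ F < h x} := fun x hx => (not_le.1 hlt).trans_le (le_maxOver m hF hx)
    have h₁ := hφ₁ F
    rw [Measure.restrict_apply (hgt _), Set.inter_eq_right.2 hsub] at h₁
    exact absurd h₁ (not_le.2 (ENNReal.half_lt_self (hpos F hF) (hfin F hF)))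
  obtain ⟨S, hSD, hS⟩ := exists_stopping_selection s m φ 𝒟
  have hstrict : ∀ F ∈ S, ∀ G ∈ S, s F ⊂ s G → 2 * φ G < m F := fun F hF =>
    (hS F (hSD hF)).1 hF
  -- Distinct stopping sets with a common point are strictly nested.
  have hnest : ∀ F ∈ S, ∀ G ∈ S, F ≠ G → ∀ x, x ∈ s F → x ∈ s G → s F ⊂ s G ∨ s G ⊂ s F := by
    intro F hF G hG hne x hxF hxG
    have hne' : s F ≠ s G := fun h => hne (hD.injOn (hSD hF) (hSD hG) h)
    rcases hD.nested F (hSD hF) G (hSD hG) with h | h | h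
    · exact Or.inl (h.ssubset_of_ne hne')
    · exact Or.inr (h.ssubset_of_ne hne'.symm)
    · exact absurd hxG (Set.disjoint_left.1 h hxF)
  have hproj : ∀ Q ∈ 𝒟, ∃ F ∈ S, s Q ⊆ s F ∧ (∀ G ∈ S, s Q ⊆ s G → s F ⊆ s G) ∧
      m Q ≤ 2 * φ F := by
    intro Q hQ
    obtain ⟨F₀, hF₀, hQF₀, hmF₀⟩ : ∃ F ∈ S, s Q ⊆ s F ∧ m Q ≤ 2 * φ F := by
      by_cases hQS : Q ∈ S
      · exact ⟨Q, hQS, subset_rfl, (hφm Q hQ).trans (le_mul_of_one_le_left zero_le one_le_two)⟩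
      · rw [hS Q hQ] at hQS
        push Not at hQS
        obtain ⟨F, hF, hQF, hmF⟩ := hQS
        exact ⟨F, hF, hQF.1, hmF⟩
    obtain ⟨F, hF, hmin⟩ := (S.filter fun F => s Q ⊆ s F).finite_toSet.exists_minimalFor s _
      ⟨F₀, Finset.mem_coe.2 (Finset.mem_filter.2 ⟨hF₀, hQF₀⟩)⟩
    obtain ⟨hFS, hQF⟩ := Finset.mem_filter.1 (Finset.mem_coe.1 hF)
    obtain ⟨x, hx⟩ := nonempty_of_measure_ne_zero (hpos Q hQ)
    have hleast : ∀ G ∈ S, s Q ⊆ s G → s F ⊆ s G := by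
      intro G hG hQG
      rcases hD.nested F (hSD hFS) G (hSD hG) with h | h | h
      · exact h
      · exact hmin (Finset.mem_coe.2 (Finset.mem_filter.2 ⟨hG, hQG⟩)) h
      · exact absurd (hQG hx) (Set.disjoint_left.1 h (hQF hx))
    refine ⟨F, hFS, hQF, hleast, hmF₀.trans ?_⟩
    rcases eq_or_ne F F₀ with rfl | hne
    · exact le_rfl
    have hss : s F ⊂ s F₀ := (hleast F₀ hF₀ hQF₀).ssubset_of_ne
      fun h => hne (hD.injOn (hSD hFS) (hSD hF₀) h)
    exact ((hstrict F hFS F₀ hF₀ hss).le.trans (hφm F (hSD hFS))).trans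
      (le_mul_of_one_le_left zero_le one_le_two)
  choose! π hπ using hproj
  refine ⟨{
    carrier := S
    level := φ
    proj := π
    core := fun F => s F ∩ {x | h x ≤ 2 * φ F}
    carrier_subset := hSD
    proj_mem := fun Q hQ => (hπ Q hQ).1
    subset_proj := fun Q hQ => (hπ Q hQ).2.1
    proj_subset := fun Q hQ => (hπ Q hQ).2.2.1
    le_level := fun Q hQ => (hπ Q hQ).2.2.2
    sum_level_le := ?_
    measurableSet_core := fun F hF => (hD.measurableSet F (hSD hF)).inter
      (measurableSet_le hmeas measurable_const)
    core_subset := fun F _ => Set.inter_subset_left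
    core_disjoint := ?_
    measure_le_core := ?_ }⟩
  · intro p hp
    have hp0 : 0 ≤ p := by linarith
    set A : ι → Set X := fun F => s F ∩ {x | φ F ≤ h x}
    have hA : ∀ F ∈ S, MeasurableSet (A F) := fun F hF =>
      (hD.measurableSet F (hSD hF)).inter (hge _)
    have hle : ∀ F ∈ S, μ (s F) ≤ 2 * μ (A F) := fun F hF => by
      have := hφ₂ F
      rw [Measure.restrict_apply (hge _), Set.inter_comm] at this
      rwa [ENNReal.div_le_iff' two_ne_zero ENNReal.ofNat_ne_top] at this
    have hpt : ∀ x, ∑ F ∈ S, (A F).indicator (fun _ => (φ F : ℝ≥0∞) ^ p) x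
        ≤ 2 * (h x : ℝ≥0∞) ^ p := by
      intro x
      have h₁ := sum_rpow_le_of_doubling (S.filter fun F => x ∈ A F) φ hp (by
        intro F hF G hG hne
        rw [Finset.mem_filter] at hF hG
        rcases hnest F hF.1 G hG.1 hne x hF.2.1 hG.2.1 with hlt | hlt
        · exact Or.inr ((hstrict F hF.1 G hG.1 hlt).trans_le (hφm F (hSD hF.1)))
        · exact Or.inl ((hstrict G hG.1 F hF.1 hlt).trans_le (hφm G (hSD hG.1)))) (h x)
        (fun F hF => (Finset.mem_filter.1 hF).2.2)
      have h₂ : ∑ F ∈ S, (A F).indicator (fun _ => (φ F : ℝ≥0∞) ^ p) x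
          = ((∑ F ∈ S with x ∈ A F, φ F ^ p : ℝ≥0) : ℝ≥0∞) := by
        rw [Finset.sum_filter, ENNReal.ofNNReal_finsetSum]
        refine Finset.sum_congr rfl fun F _ => ?_
        by_cases hx : x ∈ A F
        · rw [Set.indicator_of_mem hx, if_pos hx, ENNReal.coe_rpow_of_nonneg _ hp0]
        · rw [Set.indicator_of_notMem hx, if_neg hx, ENNReal.coe_zero]
      rw [h₂, ← ENNReal.coe_rpow_of_nonneg _ hp0]
      exact_mod_cast h₁
    calc ∑ F ∈ S, (φ F : ℝ≥0∞) ^ p * μ (s F)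
        ≤ ∑ F ∈ S, 2 * ∫⁻ x, (A F).indicator (fun _ => (φ F : ℝ≥0∞) ^ p) x ∂μ := by
          refine Finset.sum_le_sum fun F hF => ?_
          rw [lintegral_indicator_const (hA F hF), mul_left_comm]
          exact mul_le_mul_right (hle F hF) _
      _ = 2 * ∫⁻ x, ∑ F ∈ S, (A F).indicator (fun _ => (φ F : ℝ≥0∞) ^ p) x ∂μ := by
          rw [← Finset.mul_sum, lintegral_finsetSum]
          exact fun F hF => measurable_const.indicator (hA F hF)
      _ ≤ 2 * ∫⁻ x, 2 * (h x : ℝ≥0∞) ^ p ∂μ := mul_le_mul_right (lintegral_mono hpt) _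
      _ = 4 * ∫⁻ x, (h x : ℝ≥0∞) ^ p ∂μ := by
          rw [lintegral_const_mul' _ _ ENNReal.ofNat_ne_top, ← mul_assoc]
          norm_num
  · intro F hF G hG hne
    rw [Function.onFun, Set.disjoint_left]
    rintro x ⟨hxF, hxF'⟩ ⟨hxG, hxG'⟩
    simp only [Set.mem_ofPred_eq] at hxF' hxG'
    rcases hnest F hF G hG hne x hxF hxG with hlt | hlt
    · exact absurd ((hstrict F hF G hG hlt).trans_le (le_maxOver m (hSD hF) hxF)) (not_lt.2 hxG')
    · exact absurd ((hstrict G hG F hF hlt).trans_le (le_maxOver m (hSD hG) hxG)) (not_lt.2 hxF')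
  · intro F hF
    have h₁ : μ (s F ∩ {x | φ F < h x}) ≤ μ (s F) / 2 := by
      have := hφ₁ F
      rwa [Measure.restrict_apply (hgt _), Set.inter_comm] at this
    have h₂ : μ (s F) ≤ μ (s F) / 2 + μ (s F ∩ {x | h x ≤ 2 * φ F}) := by
      refine (measure_mono ?_).trans ((measure_union_le _ _).trans (add_le_add_left h₁ _))
      intro x hx
      by_cases hx' : φ F < h x
      · exact Or.inl ⟨hx, hx'⟩
      · exact Or.inr ⟨hx, (not_lt.1 hx').trans (le_mul_of_one_le_left zero_le one_le_two)⟩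
    have hhalf : μ (s F) / 2 ≠ ∞ := ENNReal.div_ne_top (hfin F (hSD hF)) two_ne_zero
    conv_lhs at h₂ => rw [← ENNReal.add_halves (μ (s F))]
    rw [ENNReal.add_le_add_iff_left hhalf,
      ENNReal.div_le_iff' two_ne_zero ENNReal.ofNat_ne_top] at h₂
    exact h₂

end Stopping

/-! ### The scalar positive form -/

section Form

variable {X ι : Type*} [MeasurableSpace X] {σ ω : Measure X} {𝒟 : Finset ι} {s : ι → Set X}
  {m n : ι → ℝ≥0}

open Classical in
/-- A stopping family for `σ` is a Carleson family for `ω` if `ω` is `A_∞` with respect to `σ`. -/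
theorem StoppingFamily.sum_measure_le (S : StoppingFamily σ 𝒟 s m) (hpos : ∀ Q ∈ 𝒟, σ (s Q) ≠ 0)
    (hfin : ∀ Q ∈ 𝒟, σ (s Q) ≠ ∞) {A : ℝ≥0∞}
    (hA : ∀ R ∈ 𝒟, ∫⁻ x, ⨆ Q ∈ 𝒟.filter fun Q => s Q ⊆ s R,
      (s Q).indicator (fun _ => ω (s Q) / σ (s Q)) x ∂σ ≤ A * ω (s R)) {R : ι} (hR : R ∈ 𝒟) :
    ∑ F ∈ S.carrier with s F ⊆ s R, ω (s F) ≤ 2 * A * ω (s R) := by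
  set S' := S.carrier.filter fun F => s F ⊆ s R
  have hS' : ∀ F ∈ S', F ∈ S.carrier := fun F hF => (Finset.mem_filter.1 hF).1
  have hD : ∀ F ∈ S', F ∈ 𝒟 := fun F hF => S.carrier_subset (hS' F hF)
  have hpt : ∀ x, ∑ F ∈ S', (S.core F).indicator (fun _ => ω (s F) / σ (s F)) x
      ≤ ⨆ Q ∈ 𝒟.filter fun Q => s Q ⊆ s R, (s Q).indicator (fun _ => ω (s Q) / σ (s Q)) x := by
    intro x
    by_cases hx : ∃ F ∈ S', x ∈ S.core F
    · obtain ⟨F, hF, hxF⟩ := hx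
      rw [Finset.sum_eq_single_of_mem F hF, Set.indicator_of_mem hxF]
      · refine le_trans ?_ (le_iSup₂ (f := fun Q (_ : Q ∈ 𝒟.filter fun Q => s Q ⊆ s R) =>
          (s Q).indicator (fun _ => ω (s Q) / σ (s Q)) x) F
          (Finset.mem_filter.2 ⟨hD F hF, (Finset.mem_filter.1 hF).2⟩))
        rw [Set.indicator_of_mem (S.core_subset F (hS' F hF) hxF)]
      · intro G hG hne
        exact Set.indicator_of_notMem (fun hxG => Set.disjoint_left.1
          (S.core_disjoint (hS' G hG) (hS' F hF) hne) hxG hxF) _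
    · push Not at hx
      rw [Finset.sum_eq_zero fun F hF => Set.indicator_of_notMem (hx F hF) _]
      exact zero_le
  calc ∑ F ∈ S', ω (s F)
      ≤ ∑ F ∈ S', 2 * ∫⁻ x, (S.core F).indicator (fun _ => ω (s F) / σ (s F)) x ∂σ := by
        refine Finset.sum_le_sum fun F hF => ?_
        rw [lintegral_indicator_const (S.measurableSet_core F (hS' F hF)), mul_left_comm]
        calc ω (s F) = ω (s F) / σ (s F) * σ (s F) :=
              (ENNReal.div_mul_cancel (hpos F (hD F hF)) (hfin F (hD F hF))).symm
          _ ≤ _ := mul_le_mul_right (S.measure_le_core F (hS' F hF)) _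
    _ = 2 * ∫⁻ x, ∑ F ∈ S', (S.core F).indicator (fun _ => ω (s F) / σ (s F)) x ∂σ := by
        rw [← Finset.mul_sum, lintegral_finsetSum]
        exact fun F hF => measurable_const.indicator (S.measurableSet_core F (hS' F hF))
    _ ≤ 2 * (A * ω (s R)) := mul_le_mul_right ((lintegral_mono hpt).trans (hA R hR)) _
    _ = 2 * A * ω (s R) := (mul_assoc _ _ _).symm

open Classical in
/-- The part of the form in which the stopping set for `σ` lies inside the one for `ω`. -/
theorem sum_le_of_proj_subset (hD : IsLaminar 𝒟 s) (S : StoppingFamily σ 𝒟 s m)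
    (T : StoppingFamily ω 𝒟 s n) (hpos : ∀ Q ∈ 𝒟, σ (s Q) ≠ 0) (hfin : ∀ Q ∈ 𝒟, σ (s Q) ≠ ∞)
    {a : ι → ℝ≥0∞} {A B : ℝ≥0∞} {p r : ℝ} (hp : 1 < p) (hr : 1 < r) (hpr : 1 ≤ 1 / p + 1 / r)
    (hA : ∀ R ∈ 𝒟, ∫⁻ x, ⨆ Q ∈ 𝒟.filter fun Q => s Q ⊆ s R,
      (s Q).indicator (fun _ => ω (s Q) / σ (s Q)) x ∂σ ≤ A * ω (s R))
    (hB : ∀ R ∈ 𝒟, ∀ u v : ℝ≥0, ∑ Q ∈ 𝒟 with s Q ⊆ s R ∧ m Q ≤ u ∧ n Q ≤ v, a Q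
      ≤ B * u * v * σ (s R) ^ (1 / p) * ω (s R) ^ (1 / r)) :
    ∑ Q ∈ 𝒟 with s (S.proj Q) ⊆ s (T.proj Q), a Q
      ≤ 128 * B * A ^ (1 / r) * (∫⁻ x, (maxOver 𝒟 s m x : ℝ≥0∞) ^ p ∂σ) ^ (1 / p)
        * (∫⁻ x, (maxOver 𝒟 s n x : ℝ≥0∞) ^ r ∂ω) ^ (1 / r) := by
  set 𝒬 := 𝒟.filter fun Q => s (S.proj Q) ⊆ s (T.proj Q)
  have h𝒬 : ∀ Q ∈ 𝒬, Q ∈ 𝒟 := fun Q hQ => (Finset.mem_filter.1 hQ).1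
  set I := ∫⁻ x, (maxOver 𝒟 s m x : ℝ≥0∞) ^ p ∂σ
  set J := ∫⁻ x, (maxOver 𝒟 s n x : ℝ≥0∞) ^ r ∂ω
  set x : ι → ℝ≥0∞ := fun F => S.level F * σ (s F) ^ (1 / p)
  set y : ι → ℝ≥0∞ := fun F => T.level (T.proj F) * ω (s F) ^ (1 / r)
  have hp0 : 0 < p := by linarith
  have hr0 : 0 < r := by linarith
  have hp1 : 1 / p ≤ 1 := (div_le_one hp0).2 hp.le
  have hr1 : 1 / r ≤ 1 := (div_le_one hr0).2 hr.le
  -- The second projection is constant on each fibre of the first one.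
  have hproj : ∀ Q ∈ 𝒬, T.proj (S.proj Q) = T.proj Q := by
    intro Q hQ
    have hQD := h𝒬 Q hQ
    have hFD := S.carrier_subset (S.proj_mem Q hQD)
    refine hD.injOn (T.carrier_subset (T.proj_mem _ hFD)) (T.carrier_subset (T.proj_mem _ hQD)) ?_
    exact Set.Subset.antisymm
      (T.proj_subset _ hFD _ (T.proj_mem _ hQD) (Finset.mem_filter.1 hQ).2)
      (T.proj_subset _ hQD _ (T.proj_mem _ hFD) ((S.subset_proj Q hQD).trans (T.subset_proj _ hFD)))
  have hfib : ∀ F ∈ S.carrier, ∑ Q ∈ 𝒬 with S.proj Q = F, a Q ≤ 4 * B * (x F * y F) := by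
    intro F hF
    calc ∑ Q ∈ 𝒬 with S.proj Q = F, a Q
        ≤ ∑ Q ∈ 𝒟 with s Q ⊆ s F ∧ m Q ≤ 2 * S.level F ∧ n Q ≤ 2 * T.level (T.proj F), a Q := by
          refine Finset.sum_le_sum_of_subset fun Q hQ => ?_
          obtain ⟨hQ', rfl⟩ := Finset.mem_filter.1 hQ
          have hQD := h𝒬 Q hQ'
          refine Finset.mem_filter.2 ⟨hQD, S.subset_proj Q hQD, S.le_level Q hQD, ?_⟩
          rw [hproj Q hQ']
          exact T.le_level Q hQD
      _ ≤ _ := hB F (S.carrier_subset hF) _ _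
      _ = 4 * B * (x F * y F) := by
          push_cast
          ring
  have hx : ∑ F ∈ S.carrier, x F ^ p ≤ 4 * I := by
    refine le_trans (le_of_eq (Finset.sum_congr rfl fun F _ => ?_)) (S.sum_level_le p hp.le)
    rw [ENNReal.mul_rpow_of_nonneg _ _ hp0.le, ← ENNReal.rpow_mul, one_div_mul_cancel hp0.ne',
      ENNReal.rpow_one]
  have hy : ∑ F ∈ S.carrier, y F ^ r ≤ 8 * A * J := by
    calc ∑ F ∈ S.carrier, y F ^ r
        = ∑ F ∈ S.carrier, (T.level (T.proj F) : ℝ≥0∞) ^ r * ω (s F) := by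
          refine Finset.sum_congr rfl fun F _ => ?_
          rw [ENNReal.mul_rpow_of_nonneg _ _ hr0.le, ← ENNReal.rpow_mul,
            one_div_mul_cancel hr0.ne', ENNReal.rpow_one]
      _ = ∑ G ∈ T.carrier, ∑ F ∈ S.carrier with T.proj F = G,
            (T.level (T.proj F) : ℝ≥0∞) ^ r * ω (s F) :=
          (Finset.sum_fiberwise_of_maps_to (fun F hF => T.proj_mem F (S.carrier_subset hF)) _).symm
      _ ≤ ∑ G ∈ T.carrier, (T.level G : ℝ≥0∞) ^ r * (2 * A * ω (s G)) := by
          refine Finset.sum_le_sum fun G hG => ?_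
          refine le_trans ?_ (mul_le_mul_right
            (S.sum_measure_le hpos hfin hA (T.carrier_subset hG)) _)
          rw [Finset.mul_sum]
          calc ∑ F ∈ S.carrier with T.proj F = G, (T.level (T.proj F) : ℝ≥0∞) ^ r * ω (s F)
              = ∑ F ∈ S.carrier with T.proj F = G, (T.level G : ℝ≥0∞) ^ r * ω (s F) :=
                Finset.sum_congr rfl fun F hF => by rw [(Finset.mem_filter.1 hF).2]
            _ ≤ _ := by
                refine Finset.sum_le_sum_of_subset fun F hF => ?_
                obtain ⟨hF', rfl⟩ := Finset.mem_filter.1 hF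
                exact Finset.mem_filter.2 ⟨hF', T.subset_proj F (S.carrier_subset hF')⟩
      _ = 2 * A * ∑ G ∈ T.carrier, (T.level G : ℝ≥0∞) ^ r * ω (s G) := by
          rw [Finset.mul_sum]
          exact Finset.sum_congr rfl fun G _ => by ring
      _ ≤ 2 * A * (4 * J) := mul_le_mul_right (T.sum_level_le r hr.le) _
      _ = 8 * A * J := by ring
  have hroot : ∀ (c z : ℝ≥0∞) {t : ℝ}, 1 ≤ c → 0 ≤ t → t ≤ 1 → (c * z) ^ t ≤ c * z ^ t := by
    intro c z t hc ht ht'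
    rw [ENNReal.mul_rpow_of_nonneg _ _ ht]
    refine mul_le_mul_left ?_ _
    calc c ^ t ≤ c ^ (1 : ℝ) := ENNReal.rpow_le_rpow_of_exponent_le hc ht'
      _ = c := ENNReal.rpow_one c
  calc ∑ Q ∈ 𝒬, a Q = ∑ F ∈ S.carrier, ∑ Q ∈ 𝒬 with S.proj Q = F, a Q :=
        (Finset.sum_fiberwise_of_maps_to (fun Q hQ => S.proj_mem Q (h𝒬 Q hQ)) _).symm
    _ ≤ ∑ F ∈ S.carrier, 4 * B * (x F * y F) := Finset.sum_le_sum hfib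
    _ = 4 * B * ∑ F ∈ S.carrier, x F * y F := by rw [Finset.mul_sum]
    _ ≤ 4 * B * ((4 * I) ^ (1 / p) * (8 * A * J) ^ (1 / r)) := by
        refine mul_le_mul_right ((sum_mul_le_rpow_mul_rpow _ x y hp hr hpr).trans ?_) _
        exact mul_le_mul' (ENNReal.rpow_le_rpow hx (by positivity))
          (ENNReal.rpow_le_rpow hy (by positivity))
    _ ≤ 4 * B * ((4 * I ^ (1 / p)) * (8 * (A ^ (1 / r) * J ^ (1 / r)))) := by
        refine mul_le_mul_right (mul_le_mul' (hroot 4 I (by norm_num) (by positivity) hp1) ?_) _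
        rw [mul_assoc, ← ENNReal.mul_rpow_of_nonneg A J (show 0 ≤ 1 / r by positivity)]
        exact hroot 8 (A * J) (by norm_num) (by positivity) hr1
    _ = 128 * B * A ^ (1 / r) * I ^ (1 / p) * J ^ (1 / r) := by ring

open Classical in
/-- The scalar form of the theorem: parallel stopping families for `m` and `n` reduce the sum to
local pieces in which both `m` and `n` are bounded. -/
theorem sum_le_of_local_bound (hD : IsLaminar 𝒟 s) (hσ : ∀ Q ∈ 𝒟, σ (s Q) ≠ 0)
    (hσ' : ∀ Q ∈ 𝒟, σ (s Q) ≠ ∞) (hω : ∀ Q ∈ 𝒟, ω (s Q) ≠ 0) (hω' : ∀ Q ∈ 𝒟, ω (s Q) ≠ ∞)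
    {a : ι → ℝ≥0∞} {A₁ A₂ B : ℝ≥0∞} {p r : ℝ} (hp : 1 < p) (hr : 1 < r) (hpr : 1 ≤ 1 / p + 1 / r)
    (hA₁ : ∀ R ∈ 𝒟, ∫⁻ x, ⨆ Q ∈ 𝒟.filter fun Q => s Q ⊆ s R,
      (s Q).indicator (fun _ => σ (s Q) / ω (s Q)) x ∂ω ≤ A₁ * σ (s R))
    (hA₂ : ∀ R ∈ 𝒟, ∫⁻ x, ⨆ Q ∈ 𝒟.filter fun Q => s Q ⊆ s R,
      (s Q).indicator (fun _ => ω (s Q) / σ (s Q)) x ∂σ ≤ A₂ * ω (s R))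
    (hB : ∀ R ∈ 𝒟, ∀ u v : ℝ≥0, ∑ Q ∈ 𝒟 with s Q ⊆ s R ∧ m Q ≤ u ∧ n Q ≤ v, a Q
      ≤ B * u * v * σ (s R) ^ (1 / p) * ω (s R) ^ (1 / r)) :
    ∑ Q ∈ 𝒟, a Q ≤ 128 * B * (A₁ ^ (1 / p) + A₂ ^ (1 / r))
        * (∫⁻ x, (maxOver 𝒟 s m x : ℝ≥0∞) ^ p ∂σ) ^ (1 / p)
        * (∫⁻ x, (maxOver 𝒟 s n x : ℝ≥0∞) ^ r ∂ω) ^ (1 / r) := by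
  obtain ⟨S⟩ := nonempty_stoppingFamily σ hD hσ hσ' m
  obtain ⟨T⟩ := nonempty_stoppingFamily ω hD hω hω' n
  have h₁ := sum_le_of_proj_subset hD S T hσ hσ' hp hr hpr hA₂ hB
  have h₂ := sum_le_of_proj_subset hD T S hω hω' hr hp (by rwa [add_comm]) hA₁
    (a := a) (B := B) (fun R hR u v => by
      have := hB R hR v u
      simp only [and_comm (a := n _ ≤ u)]
      exact this.trans_eq (by ring))
  have h₃ : ∑ Q ∈ 𝒟, a Q ≤ ∑ Q ∈ 𝒟 with s (S.proj Q) ⊆ s (T.proj Q), a Q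
      + ∑ Q ∈ 𝒟 with s (T.proj Q) ⊆ s (S.proj Q), a Q := by
    rw [← Finset.sum_filter_add_sum_filter_not 𝒟 (fun Q => s (S.proj Q) ⊆ s (T.proj Q)) a]
    refine add_le_add_right (Finset.sum_le_sum_of_subset fun Q hQ => ?_) _
    obtain ⟨hQ, hns⟩ := Finset.mem_filter.1 hQ
    refine Finset.mem_filter.2 ⟨hQ, ?_⟩
    -- Both stopping sets contain the nonempty set `s Q`, so they are nested.
    obtain ⟨x, hx⟩ := nonempty_of_measure_ne_zero (hσ Q hQ)
    rcases hD.nested _ (S.carrier_subset (S.proj_mem Q hQ)) _ (T.carrier_subset (T.proj_mem Q hQ))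
      with h | h | h
    · exact absurd h hns
    · exact h
    · exact absurd (T.subset_proj Q hQ hx) (Set.disjoint_left.1 h (S.subset_proj Q hQ hx))
  refine (h₃.trans (add_le_add h₁ h₂)).trans (le_of_eq ?_)
  ring

end Form

/-! ### Geometry of dyadic cubes -/

namespace DyadicCube

variable {d : ℕ}

theorem toSet_eq_pi (Q : DyadicCube d) :
    Q.toSet = Set.univ.pi fun i => Set.Ico ((2 : ℝ) ^ (-Q.scale) * (Q.corner i : ℝ))
      ((2 : ℝ) ^ (-Q.scale) * ((Q.corner i : ℝ) + 1)) := by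
  ext x
  simp [toSet]

theorem measurableSet_toSet (Q : DyadicCube d) : MeasurableSet Q.toSet := by
  rw [toSet_eq_pi]
  exact MeasurableSet.univ_pi fun _ => measurableSet_Ico

theorem volume_toSet (Q : DyadicCube d) :
    volume Q.toSet = ENNReal.ofReal ((2 : ℝ) ^ (-Q.scale)) ^ d := by
  rw [toSet_eq_pi, Real.volume_pi_Ico]
  simp only [← mul_sub, add_sub_cancel_left, mul_one, Finset.prod_const, Finset.card_univ,
    Fintype.card_fin]

theorem volume_toSet_ne_zero (Q : DyadicCube d) : volume Q.toSet ≠ 0 := by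
  rw [volume_toSet]
  exact pow_ne_zero _ (ENNReal.ofReal_pos.2 (by positivity)).ne'

theorem volume_toSet_ne_top (Q : DyadicCube d) : volume Q.toSet ≠ ∞ := by
  rw [volume_toSet]
  exact ENNReal.pow_ne_top ENNReal.ofReal_ne_top

theorem measure_toSet_ne_top (μ : Measure (Fin d → ℝ)) [IsLocallyFiniteMeasure μ]
    (Q : DyadicCube d) : μ Q.toSet ≠ ∞ := by
  refine ((measure_mono ?_).trans_lt (isCompact_univ_pi fun i => isCompact_Icc
    (a := (2 : ℝ) ^ (-Q.scale) * (Q.corner i : ℝ))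
    (b := (2 : ℝ) ^ (-Q.scale) * ((Q.corner i : ℝ) + 1))).measure_lt_top).ne
  rw [toSet_eq_pi]
  exact Set.pi_mono fun i _ => Set.Ico_subset_Icc_self

/-- The lower corner of a dyadic cube belongs to the cube. -/
theorem lowerCorner_mem (Q : DyadicCube d) :
    (fun i => (2 : ℝ) ^ (-Q.scale) * (Q.corner i : ℝ)) ∈ Q.toSet := fun i =>
  ⟨le_rfl, mul_lt_mul_of_pos_left (lt_add_one _) (by positivity)⟩

theorem eq_of_mem_of_scale_eq {Q R : DyadicCube d} (h : Q.scale = R.scale) {x : Fin d → ℝ}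
    (hQ : x ∈ Q.toSet) (hR : x ∈ R.toSet) : Q = R := by
  obtain ⟨k, c⟩ := Q
  obtain ⟨l, e⟩ := R
  obtain rfl : k = l := h
  congr 1
  funext i
  have h2 : (0 : ℝ) < 2 ^ (-k) := by positivity
  have h₁ := lt_of_mul_lt_mul_left ((hQ i).1.trans_lt (hR i).2) h2.le
  have h₂ := lt_of_mul_lt_mul_left ((hR i).1.trans_lt (hQ i).2) h2.le
  have h₁' : c i < e i + 1 := by exact_mod_cast h₁
  have h₂' : e i < c i + 1 := by exact_mod_cast h₂
  omega

theorem subset_or_disjoint {Q R : DyadicCube d} (h : Q.scale ≤ R.scale) :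
    R.toSet ⊆ Q.toSet ∨ Disjoint R.toSet Q.toSet := by
  by_cases hd : Disjoint R.toSet Q.toSet
  · exact Or.inr hd
  left
  obtain ⟨x, hxR, hxQ⟩ := Set.not_disjoint_iff.1 hd
  obtain ⟨l, hl⟩ := Int.le.dest h
  have hpow : (2 : ℝ) ^ (-Q.scale) = 2 ^ (-R.scale) * 2 ^ l := by
    rw [← zpow_natCast, ← zpow_add₀ two_ne_zero]
    congr 1
    omega
  have h2 : (0 : ℝ) < 2 ^ (-R.scale) := by positivity
  intro y hy i
  have hxR' := hxR i
  have hxQ' := hxQ i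
  rw [hpow, mul_assoc, mul_assoc] at hxQ' ⊢
  have h₁ := lt_of_mul_lt_mul_left (hxQ'.1.trans_lt hxR'.2) h2.le
  have h₂ := lt_of_mul_lt_mul_left (hxR'.1.trans_lt hxQ'.2) h2.le
  have h₁' : (2 : ℤ) ^ l * Q.corner i < R.corner i + 1 := by exact_mod_cast h₁
  have h₂' : R.corner i < (2 : ℤ) ^ l * (Q.corner i + 1) := by exact_mod_cast h₂
  have h₁'' : (2 : ℝ) ^ l * Q.corner i ≤ R.corner i := by exact_mod_cast Int.lt_add_one_iff.1 h₁'
  have h₂'' : (R.corner i : ℝ) + 1 ≤ 2 ^ l * (Q.corner i + 1) := by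
    exact_mod_cast Int.add_one_le_iff.2 h₂'
  exact ⟨(mul_le_mul_of_nonneg_left h₁'' h2.le).trans (hy i).1,
    (hy i).2.trans_le (mul_le_mul_of_nonneg_left h₂'' h2.le)⟩

theorem toSet_injective (hd : 0 < d) : Function.Injective (toSet : DyadicCube d → _) := by
  intro Q R h
  have hv := congrArg volume h
  rw [volume_toSet, volume_toSet] at hv
  have hv' := (ENNReal.pow_right_strictMono hd.ne').injective hv
  have h2 : (2 : ℝ) ^ (-Q.scale) = 2 ^ (-R.scale) :=
    (ENNReal.ofReal_eq_ofReal_iff (by positivity) (by positivity)).1 hv'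
  have hs : Q.scale = R.scale := by
    have := zpow_right_injective₀ (a := (2 : ℝ)) two_pos (by norm_num) h2
    omega
  exact eq_of_mem_of_scale_eq hs Q.lowerCorner_mem (h ▸ Q.lowerCorner_mem)

theorem isLaminar (hd : 0 < d) (𝒟 : Finset (DyadicCube d)) : IsLaminar 𝒟 toSet where
  measurableSet Q _ := Q.measurableSet_toSet
  injOn := (toSet_injective hd).injOn
  nested Q _ R _ := by
    rcases le_total Q.scale R.scale with h | h
    · exact Or.inr ((subset_or_disjoint h).imp_right fun h => h.symm)
    · exact (subset_or_disjoint h).imp_right Or.inr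

/-- A dyadic cube contains arbitrarily many disjoint dyadic cubes of equal volume that together have
its full volume. -/
theorem exists_subdivision (hd : 0 < d) (P : DyadicCube d) (N : ℕ) :
    ∃ 𝒬 : Finset (DyadicCube d), N ≤ 𝒬.card ∧ (∀ R ∈ 𝒬, R.toSet ⊆ P.toSet) ∧
      (∀ R ∈ 𝒬, (𝒬.card : ℝ≥0∞) * volume R.toSet = volume P.toSet) ∧
      Set.PairwiseDisjoint (𝒬 : Set (DyadicCube d)) toSet := by
  classical
  set sub : (Fin d → Fin (2 ^ N)) → DyadicCube d := fun j =>
    ⟨P.scale + N, fun i => 2 ^ N * P.corner i + (j i : ℕ)⟩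
  have hinj : Function.Injective sub := by
    intro j j' h
    funext i
    have := congrFun (congrArg corner h) i
    simp only [sub, add_right_inj, Nat.cast_inj] at this
    exact Fin.ext this
  have hscale : ∀ R ∈ Finset.univ.image sub, R.scale = P.scale + N := by
    intro R hR
    obtain ⟨j, -, rfl⟩ := Finset.mem_image.1 hR
    rfl
  have hpow : (2 : ℝ) ^ (-P.scale) = 2 ^ N * 2 ^ (-(P.scale + N)) := by
    rw [← zpow_natCast, ← zpow_add₀ two_ne_zero]
    congr 1
    omega
  have hcard : (Finset.univ.image sub).card = (2 ^ N) ^ d := by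
    rw [Finset.card_image_of_injective _ hinj]
    simp
  refine ⟨Finset.univ.image sub, ?_, ?_, ?_, ?_⟩
  · rw [hcard]
    exact Nat.lt_two_pow_self.le.trans (Nat.le_self_pow hd.ne' _)
  · intro R hR
    have hRs := hscale R hR
    refine (subset_or_disjoint (by omega)).resolve_right
      (Set.not_disjoint_iff.2 ⟨_, R.lowerCorner_mem, ?_⟩)
    obtain ⟨j, -, rfl⟩ := Finset.mem_image.1 hR
    intro i
    have h2 : (0 : ℝ) < 2 ^ (-(P.scale + N)) := by positivity
    have hj : ((j i : ℕ) : ℝ) < 2 ^ N := by exact_mod_cast (j i).2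
    have hj0 : (0 : ℝ) ≤ ((j i : ℕ) : ℝ) := Nat.cast_nonneg _
    simp only [sub]
    push_cast
    rw [hpow]
    constructor
    · nlinarith [mul_nonneg h2.le hj0]
    · nlinarith [mul_pos h2 (sub_pos.2 hj)]
  · intro R hR
    rw [hcard, volume_toSet, volume_toSet, hscale R hR, hpow,
      ENNReal.ofReal_mul (by positivity), mul_pow]
    congr 1
    rw [ENNReal.ofReal_pow (by norm_num)]
    norm_num
  · intro Q hQ R hR hne
    rw [Function.onFun, Set.disjoint_left]
    intro x hxQ hxR
    exact hne (eq_of_mem_of_scale_eq ((hscale Q hQ).trans (hscale R hR).symm) hxQ hxR)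

end DyadicCube

/-! ### Elementary properties of the lattice maximal operator -/

section LatticeMaximal

variable {d : ℕ} {E : Type*} [NormedAddCommGroup E] [NormedSpace ℝ E] [Lattice E]

theorem le_latticeMaximal {𝒟 : Finset (DyadicCube d)} {Q : DyadicCube d} (hQ : Q ∈ 𝒟)
    (f : (Fin d → ℝ) → E) {x : Fin d → ℝ} (hx : x ∈ Q.toSet) :
    ⨍ y in Q.toSet, f y ≤ latticeMaximal 𝒟 f x := by
  rw [latticeMaximal, dif_pos ⟨Q, hQ⟩]
  have h := Finset.le_sup' (fun Q => Q.toSet.indicator (fun _ => ⨍ y in Q.toSet, f y) x) hQ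
  simpa only [Set.indicator_of_mem hx] using h

theorem latticeMaximal_le {𝒟 : Finset (DyadicCube d)} {f : (Fin d → ℝ) → E} {x : Fin d → ℝ} {b : E}
    (hb : 0 ≤ b) (h : ∀ Q ∈ 𝒟, x ∈ Q.toSet → ⨍ y in Q.toSet, f y ≤ b) :
    latticeMaximal 𝒟 f x ≤ b := by
  rw [latticeMaximal]
  split_ifs with hne
  · refine Finset.sup'_le _ _ fun Q hQ => ?_
    by_cases hx : x ∈ Q.toSet
    · simpa only [Set.indicator_of_mem hx] using h Q hQ hx
    · simpa only [Set.indicator_of_notMem hx] using hb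
  · exact hb

variable [HasSolidNorm E] [IsOrderedAddMonoid E] [IsOrderedModule ℝ E]

theorem average_nonneg {X : Type*} [MeasurableSpace X] {μ : Measure X} {f : X → E} (hf : 0 ≤ f) :
    0 ≤ ⨍ x, f x ∂μ :=
  integral_nonneg hf

theorem latticeMaximal_nonneg (𝒟 : Finset (DyadicCube d)) {f : (Fin d → ℝ) → E} (hf : 0 ≤ f)
    (x : Fin d → ℝ) : 0 ≤ latticeMaximal 𝒟 f x := by
  rw [latticeMaximal]
  split_ifs with hne
  · obtain ⟨Q, hQ⟩ := hne
    refine le_trans ?_ (Finset.le_sup' _ hQ)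
    exact Set.indicator_nonneg (fun _ _ => average_nonneg hf) x
  · exact le_rfl

theorem smul_sup_le {a b z : E} {c : ℝ} (hc : 0 < c) (ha : c • a ≤ z) (hb : c • b ≤ z) :
    c • (a ⊔ b) ≤ z := by
  rw [← le_inv_smul_iff_of_pos hc] at ha hb ⊢
  exact sup_le ha hb

theorem smul_le_self_of_le_one {a : E} (ha : 0 ≤ a) {c : ℝ} (hc : c ≤ 1) : c • a ≤ a := by
  simpa using smul_le_smul_of_nonneg_right hc ha

end LatticeMaximal

section Realizable

variable {d : ℕ} {E : Type*} [NormedAddCommGroup E] [NormedSpace ℝ E] [Lattice E]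

/-- The triple `(u, N, V)` of an average `u`, a `p`-th moment `N`, and the `p`-th moment `V e` of a
maximal function with initial value `e`, is realized, up to factors arbitrarily close to `1`, on
every dyadic cube `P` by a function `F ≥ 0` with Lebesgue averages and finitely many dyadic
subcubes of `P`. -/
def Realizable (d : ℕ) (p : ℝ) (u : E) (N : ℝ≥0∞) (V : E → ℝ≥0∞) : Prop :=
  ∀ ρ : ℝ, 0 < ρ → ρ < 1 → ∀ P : DyadicCube d,
    ∃ (𝒮 : Finset (DyadicCube d)) (F : (Fin d → ℝ) → E),
      P ∈ 𝒮 ∧ (∀ S ∈ 𝒮, S.toSet ⊆ P.toSet) ∧ MemLp F (ENNReal.ofReal p) volume ∧ 0 ≤ F ∧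
      (∀ x ∉ P.toSet, F x = 0) ∧ (ρ * volume.real P.toSet) • u ≤ ∫ x, F x ∧
      ∫⁻ x, ‖F x‖ₑ ^ p ≤ N * volume P.toSet ∧
      ∀ (e e' : E) (c : ℝ), 0 ≤ e → 0 < c → c ≤ ρ → c • e ≤ e' →
        ENNReal.ofReal ρ * ENNReal.ofReal c ^ p * V e * volume P.toSet
          ≤ ∫⁻ x in P.toSet, ‖e' ⊔ latticeMaximal 𝒮 F x‖ₑ ^ p

theorem Realizable.mono {p : ℝ} {u : E} {N N' : ℝ≥0∞} {V V' : E → ℝ≥0∞} (h : Realizable d p u N V)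
    (hN : N ≤ N') (hV : ∀ e, 0 ≤ e → V' e ≤ V e) : Realizable d p u N' V' := by
  intro ρ hρ hρ1 P
  obtain ⟨𝒮, F, h₁, h₂, h₃, h₄, h₅, h₆, h₇, h₈⟩ := h ρ hρ hρ1 P
  refine ⟨𝒮, F, h₁, h₂, h₃, h₄, h₅, h₆, h₇.trans (mul_le_mul_left hN _),
    fun e e' c he hc hcρ hee => le_trans ?_ (h₈ e e' c he hc hcρ hee)⟩
  exact mul_le_mul_left (mul_le_mul_right (hV e he) _) _

theorem integrable_of_memLp_of_support_subset {p : ℝ} (hp : 1 ≤ p) {F : (Fin d → ℝ) → E}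
    (hF : MemLp F (ENNReal.ofReal p) volume) {P : DyadicCube d} (hP : ∀ x ∉ P.toSet, F x = 0) :
    Integrable F := by
  have hind : P.toSet.indicator F = F := by
    rw [Set.indicator_eq_self]
    exact fun x hx => by_contra fun hxP => hx (hP x hxP)
  have : IsFiniteMeasure (volume.restrict P.toSet) :=
    ⟨by simpa using P.volume_toSet_ne_top.lt_top⟩
  rw [← hind, integrable_indicator_iff P.measurableSet_toSet]
  exact (hF.restrict _).integrable (by simpa using hp)

variable [HasSolidNorm E] [IsOrderedAddMonoid E] [IsOrderedModule ℝ E] [CompleteSpace E]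

/-- A constant function on `P` realizes a martingale without steps. -/
theorem realizable_const {p : ℝ} (hp : 1 ≤ p) {u : E} (hu : 0 ≤ u) :
    Realizable d p u (‖u‖ₑ ^ p) fun e => ‖e ⊔ u‖ₑ ^ p := by
  intro ρ hρ hρ1 P
  have hp0 : 0 < p := by linarith
  have hint : ∫ x, P.toSet.indicator (fun _ => u) x = volume.real P.toSet • u :=
    integral_indicator_const u P.measurableSet_toSet
  refine ⟨{P}, P.toSet.indicator fun _ => u, Finset.mem_singleton_self P, by simp,
    memLp_indicator_const _ P.measurableSet_toSet _ (Or.inr P.volume_toSet_ne_top),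
    Set.indicator_nonneg fun _ _ => hu, fun x hx => Set.indicator_of_notMem hx _, ?_, ?_, ?_⟩
  · rw [hint, mul_smul]
    exact smul_le_self_of_le_one (smul_nonneg measureReal_nonneg hu) hρ1.le
  · refine le_of_eq ?_
    rw [← lintegral_indicator_const P.measurableSet_toSet]
    congr 1
    funext x
    by_cases hx : x ∈ P.toSet <;> simp [hx, hp0]
  · intro e e' c he hc hcρ hee
    have hle : ∀ x ∈ P.toSet, ENNReal.ofReal c ^ p * ‖e ⊔ u‖ₑ ^ p
        ≤ ‖e' ⊔ latticeMaximal {P} (P.toSet.indicator fun _ => u) x‖ₑ ^ p := by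
      intro x hx
      have havg : u ≤ latticeMaximal {P} (P.toSet.indicator fun _ => u) x := by
        refine le_trans (le_of_eq ?_) (le_latticeMaximal (Finset.mem_singleton_self P) _ hx)
        rw [setAverage_eq, setIntegral_indicator P.measurableSet_toSet, Set.inter_self,
          setIntegral_const, smul_smul, inv_mul_cancel₀, one_smul]
        exact (measureReal_ne_zero_iff P.volume_toSet_ne_top).2 P.volume_toSet_ne_zero
      have h₁ : c • (e ⊔ u) ≤ e' ⊔ latticeMaximal {P} (P.toSet.indicator fun _ => u) x :=
        smul_sup_le hc (hee.trans le_sup_left)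
          ((smul_le_self_of_le_one hu (hcρ.trans hρ1.le)).trans (havg.trans le_sup_right))
      have h₂ := enorm_mono_of_nonneg (smul_nonneg hc.le (he.trans le_sup_left)) h₁
      rw [enorm_smul, Real.enorm_of_nonneg hc.le] at h₂
      rw [← ENNReal.mul_rpow_of_nonneg _ _ hp0.le]
      exact ENNReal.rpow_le_rpow h₂ hp0.le
    calc ENNReal.ofReal ρ * ENNReal.ofReal c ^ p * ‖e ⊔ u‖ₑ ^ p * volume P.toSet
        ≤ 1 * (ENNReal.ofReal c ^ p * ‖e ⊔ u‖ₑ ^ p) * volume P.toSet := by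
          rw [mul_assoc (ENNReal.ofReal ρ)]
          exact mul_le_mul_left (mul_le_mul_left (ENNReal.ofReal_le_one.2 hρ1.le) _) _
      _ = ∫⁻ x in P.toSet, ENNReal.ofReal c ^ p * ‖e ⊔ u‖ₑ ^ p := by
          rw [setLIntegral_const, one_mul]
      _ ≤ _ := setLIntegral_mono' P.measurableSet_toSet hle

end Realizable

/-! ### Copying a martingale into Lebesgue measure -/

section Labelling

/-- A large finite set has a subset that is labelled by `Bool` in prescribed proportions, up to a
factor close to `1`. -/
theorem exists_labelling {ι : Type*} (𝒬 : Finset ι) {t : Bool → ℝ} (ht : ∀ b, 0 < t b)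
    (hsum : ∑ b, t b = 1) {ρ : ℝ} (hρ : ∀ b, 1 ≤ t b * (1 - ρ) * 𝒬.card) :
    ∃ T ⊆ 𝒬, ∃ lab : ι → Bool, ∀ b, ρ * t b * 𝒬.card ≤ (T.filter fun R => lab R = b).card ∧
      ((T.filter fun R => lab R = b).card : ℝ) ≤ t b * 𝒬.card := by
  classical
  set n : Bool → ℕ := fun b => ⌊t b * 𝒬.card⌋₊
  have hn : ∀ b, (n b : ℝ) ≤ t b * 𝒬.card := fun b =>
    Nat.floor_le (mul_nonneg (ht b).le (Nat.cast_nonneg _))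
  have hn' : ∀ b, ρ * t b * 𝒬.card ≤ n b := fun b => by
    have h₁ := Nat.lt_floor_add_one (t b * 𝒬.card)
    have h₂ := hρ b
    change _ < (n b : ℝ) + 1 at h₁
    linarith
  rw [Fintype.sum_bool] at hsum
  have hcard : n true + n false ≤ 𝒬.card := by
    have h₁ := hn true
    have h₂ := hn false
    have : (n true : ℝ) + n false ≤ 𝒬.card := by
      calc (n true : ℝ) + n false ≤ (t true + t false) * 𝒬.card := by linarith
        _ = 𝒬.card := by rw [hsum, one_mul]
    exact_mod_cast this
  obtain ⟨T₁, hT₁, hc₁⟩ := Finset.exists_subset_card_eq (le_of_add_le_left hcard)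
  obtain ⟨T₂, hT₂, hc₂⟩ := Finset.exists_subset_card_eq (s := 𝒬 \ T₁) (n := n false) (by
    rw [Finset.card_sdiff_of_subset hT₁]
    omega)
  have hdisj : ∀ R ∈ T₂, R ∉ T₁ := fun R h₂ => (Finset.mem_sdiff.1 (hT₂ h₂)).2
  refine ⟨T₁ ∪ T₂, Finset.union_subset hT₁ (hT₂.trans Finset.sdiff_subset),
    fun R => decide (R ∈ T₁), fun b => ?_⟩
  have hb : ((T₁ ∪ T₂).filter fun R => decide (R ∈ T₁) = b).card = n b := by
    cases b
    · rw [← hc₂]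
      congr 1
      ext R
      have := hdisj R
      simp only [decide_eq_false_iff_not, Finset.mem_filter, Finset.mem_union]
      tauto
    · rw [← hc₁]
      congr 1
      ext R
      simp only [decide_eq_true_eq, Finset.mem_filter, Finset.mem_union]
      tauto
  rw [hb]
  exact ⟨hn' b, hn b⟩

theorem sum_label_eq {ι M : Type*} [AddCommMonoid M] (T : Finset ι) (lab : ι → Bool) (G : Bool → M) :
    ∑ R ∈ T, G (lab R) = ∑ b, (T.filter fun R => lab R = b).card • G b := by
  rw [← Finset.sum_fiberwise T lab fun R => G (lab R)]
  refine Finset.sum_congr rfl fun b _ => ?_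
  rw [← Finset.sum_const]
  exact Finset.sum_congr rfl fun R hR => by rw [(Finset.mem_filter.1 hR).2]

end Labelling

section Realizable

variable {d : ℕ} {E : Type*} [NormedAddCommGroup E] [NormedSpace ℝ E] [Lattice E]
 [HasSolidNorm E] [IsOrderedAddMonoid E] [IsOrderedModule ℝ E] [CompleteSpace E]

/-- Realizability is preserved under one step of a martingale. -/
theorem realizable_mix (hd : 0 < d) {p : ℝ} (hp : 1 ≤ p) {t : Bool → ℝ} (ht : ∀ b, 0 < t b)
    (hsum : ∑ b, t b = 1) {u : Bool → E} {N : Bool → ℝ≥0∞} {V : Bool → E → ℝ≥0∞}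
    (hu : ∀ b, 0 ≤ u b) (h : ∀ b, Realizable d p (u b) (N b) (V b)) :
    Realizable d p (∑ b, t b • u b) (∑ b, ENNReal.ofReal (t b) * N b)
      fun e => ∑ b, ENNReal.ofReal (t b) * V b (e ⊔ ∑ b', t b' • u b') := by
  classical
  have hp0 : 0 < p := by linarith
  intro ρ₀ hρ₀ hρ₀1 P
  set a := ∑ b, t b • u b with ha
  have ha0 : 0 ≤ a := Finset.sum_nonneg fun b _ => smul_nonneg (ht b).le (hu b)
  -- The factor `ρ` is lost twice: in the proportions and in the pieces.
  obtain ⟨ρ, hρ, hρ1, hρρ⟩ : ∃ ρ : ℝ, 0 < ρ ∧ ρ < 1 ∧ ρ * ρ = ρ₀ :=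
    ⟨√ρ₀, Real.sqrt_pos.2 hρ₀, (Real.sqrt_lt_sqrt hρ₀.le hρ₀1).trans_eq Real.sqrt_one,
      Real.mul_self_sqrt hρ₀.le⟩
  have hρ₀ρ : ρ₀ ≤ ρ := by nlinarith
  obtain ⟨m, hm⟩ := exists_nat_ge (∑ b, 1 / (t b * (1 - ρ)))
  obtain ⟨𝒬, hcard, h𝒬P, hvol, hdisj⟩ := P.exists_subdivision hd m
  have hbig : ∀ b, 1 ≤ t b * (1 - ρ) * 𝒬.card := fun b => by
    have hpos : ∀ b, 0 < t b * (1 - ρ) := fun b => mul_pos (ht b) (sub_pos.2 hρ1)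
    rw [mul_comm, ← div_le_iff₀ (hpos b)]
    refine (Finset.single_le_sum (f := fun b => 1 / (t b * (1 - ρ)))
      (fun b _ => (one_div_pos.2 (hpos b)).le) (Finset.mem_univ b)).trans (hm.trans ?_)
    exact_mod_cast hcard
  obtain ⟨T, hT, lab, hcards⟩ := exists_labelling 𝒬 ht hsum hbig
  set n : Bool → ℕ := fun b => (T.filter fun R => lab R = b).card
  have hn : ∀ b, ρ * t b * 𝒬.card ≤ n b := fun b => (hcards b).1
  have hn' : ∀ b, (n b : ℝ) ≤ t b * 𝒬.card := fun b => (hcards b).2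
  choose 𝒮 F hR𝒮 h𝒮R hmem hF0 hsupp hint hmom hmax using fun R => h (lab R) ρ hρ hρ1 R
  have hTP : ∀ R ∈ T, R.toSet ⊆ P.toSet := fun R hR => h𝒬P R (hT hR)
  -- Each cube of the subdivision has volume `v`.
  set v := volume P.toSet / 𝒬.card with hv
  have hcard0 : (𝒬.card : ℝ≥0∞) ≠ 0 := by
    intro h0
    have := hbig true
    rw [Nat.cast_eq_zero.1 h0] at this
    norm_num at this
  have hvolR : ∀ R ∈ T, volume R.toSet = v := fun R hR => by
    rw [hv, ← hvol R (hT hR), mul_comm, ENNReal.mul_div_cancel_right hcard0 (by simp)]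
  have hvcard : volume P.toSet = 𝒬.card * v := by
    rw [hv, ENNReal.mul_div_cancel hcard0 (by simp)]
  have hlow : ∀ b, ENNReal.ofReal (ρ * t b) * volume P.toSet ≤ n b * v := fun b => by
    rw [hvcard, ← mul_assoc]
    refine mul_le_mul_left ?_ _
    rw [← ENNReal.ofReal_natCast, ← ENNReal.ofReal_natCast, ← ENNReal.ofReal_mul (by
      have := ht b; positivity)]
    exact ENNReal.ofReal_le_ofReal (hn b)
  have hupp : ∀ b, n b * v ≤ ENNReal.ofReal (t b) * volume P.toSet := fun b => by
    rw [hvcard, ← mul_assoc]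
    refine mul_le_mul_left ?_ _
    rw [← ENNReal.ofReal_natCast, ← ENNReal.ofReal_natCast, ← ENNReal.ofReal_mul (ht b).le]
    exact ENNReal.ofReal_le_ofReal (hn' b)
  have hvtop : v ≠ ∞ := ENNReal.div_ne_top P.volume_toSet_ne_top hcard0
  have hlow' : ∀ b, ρ * t b * volume.real P.toSet ≤ n b * v.toReal := fun b => by
    have := ENNReal.toReal_mono (ENNReal.mul_ne_top (by simp) hvtop) (hlow b)
    rwa [ENNReal.toReal_mul, ENNReal.toReal_mul, ENNReal.toReal_natCast,
      ENNReal.toReal_ofReal (mul_nonneg hρ.le (ht b).le)] at this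
  set G : (Fin d → ℝ) → E := fun x => ∑ R ∈ T, F R x with hG
  have hGR : ∀ R ∈ T, ∀ x ∈ R.toSet, G x = F R x := by
    intro R hR x hx
    refine Finset.sum_eq_single_of_mem R hR fun R' hR' hne => hsupp R' x fun hx' => ?_
    exact Set.disjoint_left.1 (hdisj (hT hR') (hT hR) hne) hx' hx
  have hG0 : 0 ≤ G := fun x => Finset.sum_nonneg fun R _ => hF0 R x
  have hGP : ∀ x ∉ P.toSet, G x = 0 := fun x hx =>
    Finset.sum_eq_zero fun R hR => hsupp R x fun hxR => hx (hTP R hR hxR)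
  have hGint : ρ₀ • volume.real P.toSet • a ≤ ∫ x, G x := by
    rw [hG, integral_finsetSum _ fun R _ =>
      integrable_of_memLp_of_support_subset hp (hmem R) (hsupp R)]
    calc ρ₀ • volume.real P.toSet • a
        = ∑ b, (ρ * (ρ * t b * volume.real P.toSet)) • u b := by
          rw [ha, Finset.smul_sum, Finset.smul_sum]
          refine Finset.sum_congr rfl fun b _ => ?_
          rw [smul_smul, smul_smul, ← hρρ]
          congr 1
          ring
      _ ≤ ∑ b, (ρ * (n b * v.toReal)) • u b := Finset.sum_le_sum fun b _ =>
          smul_le_smul_of_nonneg_right (mul_le_mul_of_nonneg_left (hlow' b) hρ.le) (hu b)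
      _ = ∑ b, n b • ((ρ * v.toReal) • u b) := by
          refine Finset.sum_congr rfl fun b _ => ?_
          rw [← Nat.cast_smul_eq_nsmul ℝ, smul_smul]
          congr 1
          ring
      _ = ∑ R ∈ T, (ρ * v.toReal) • u (lab R) := (sum_label_eq T lab fun b => (ρ * v.toReal) • u b).symm
      _ ≤ ∑ R ∈ T, ∫ x, F R x := Finset.sum_le_sum fun R hR => by
          have := hint R
          rwa [measureReal_def, hvolR R hR] at this
  refine ⟨insert P (T.biUnion 𝒮), G, Finset.mem_insert_self _ _, ?_, ?_, hG0, hGP, ?_, ?_, ?_⟩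
  · intro S hS
    rcases Finset.mem_insert.1 hS with rfl | hS
    · exact subset_rfl
    · obtain ⟨R, hR, hSR⟩ := Finset.mem_biUnion.1 hS
      exact (h𝒮R R S hSR).trans (hTP R hR)
  · exact memLp_finsetSum _ fun R _ => hmem R
  · rwa [mul_smul]
  · calc ∫⁻ x, ‖G x‖ₑ ^ p ≤ ∫⁻ x, ∑ R ∈ T, ‖F R x‖ₑ ^ p := by
          refine lintegral_mono fun x => ?_
          by_cases hx : ∃ R ∈ T, x ∈ R.toSet
          · obtain ⟨R, hR, hxR⟩ := hx
            simp only [hGR R hR x hxR]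
            exact Finset.single_le_sum (f := fun R => ‖F R x‖ₑ ^ p) (fun _ _ => zero_le) hR
          · push Not at hx
            have : G x = 0 := Finset.sum_eq_zero fun R hR => hsupp R x (hx R hR)
            simp [this, hp0]
      _ = ∑ R ∈ T, ∫⁻ x, ‖F R x‖ₑ ^ p :=
          lintegral_finsetSum' _ fun R _ => (hmem R).1.enorm.pow_const p
      _ ≤ ∑ R ∈ T, N (lab R) * v := Finset.sum_le_sum fun R hR => by
          have := hmom R
          rwa [hvolR R hR] at this
      _ = ∑ b, n b • (N b * v) := sum_label_eq T lab fun b => N b * v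
      _ ≤ ∑ b, ENNReal.ofReal (t b) * volume P.toSet * N b := Finset.sum_le_sum fun b _ => by
          rw [nsmul_eq_mul, mul_comm (N b), ← mul_assoc]
          exact mul_le_mul_left (hupp b) _
      _ = _ := by
          rw [Finset.sum_mul]
          exact Finset.sum_congr rfl fun b _ => by ring
  · intro e e' c he hc hcρ hee
    set 𝒮' := insert P (T.biUnion 𝒮)
    set w := e' ⊔ ⨍ y in P.toSet, G y
    have hw : c • (e ⊔ a) ≤ w := by
      refine smul_sup_le hc (hee.trans le_sup_left) (le_trans ?_ le_sup_right)
      have hPpos : 0 < volume.real P.toSet :=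
        ENNReal.toReal_pos P.volume_toSet_ne_zero P.volume_toSet_ne_top
      rw [setAverage_eq, setIntegral_eq_integral_of_forall_compl_eq_zero hGP,
        le_inv_smul_iff_of_pos hPpos, smul_comm]
      refine le_trans ?_ hGint
      exact smul_le_smul_of_nonneg_right hcρ (smul_nonneg hPpos.le ha0)
    have hloc : ∀ R ∈ T, ∀ x ∈ R.toSet,
        w ⊔ latticeMaximal (𝒮 R) (F R) x ≤ e' ⊔ latticeMaximal 𝒮' G x := by
      intro R hR x hx
      refine sup_le (sup_le le_sup_left (le_trans ?_ le_sup_right)) (le_trans ?_ le_sup_right)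
      · exact le_latticeMaximal (Finset.mem_insert_self _ _) G (hTP R hR hx)
      · refine latticeMaximal_le (latticeMaximal_nonneg _ hG0 x) fun Q hQ hxQ => ?_
        rw [← setAverage_congr_fun Q.measurableSet_toSet
          (Filter.Eventually.of_forall fun y hy => hGR R hR y (h𝒮R R Q hQ hy))]
        exact le_latticeMaximal (Finset.mem_insert_of_mem
          (Finset.mem_biUnion.2 ⟨R, hR, hQ⟩)) G hxQ
    calc ENNReal.ofReal ρ₀ * ENNReal.ofReal c ^ p * (∑ b, ENNReal.ofReal (t b) * V b (e ⊔ a))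
          * volume P.toSet
        = ∑ b, ENNReal.ofReal (ρ * t b) * volume P.toSet *
            (ENNReal.ofReal ρ * ENNReal.ofReal c ^ p * V b (e ⊔ a)) := by
          rw [Finset.mul_sum, Finset.sum_mul]
          refine Finset.sum_congr rfl fun b _ => ?_
          rw [← hρρ, ENNReal.ofReal_mul hρ.le, ENNReal.ofReal_mul hρ.le]
          ring
      _ ≤ ∑ b, n b * v * (ENNReal.ofReal ρ * ENNReal.ofReal c ^ p * V b (e ⊔ a)) :=
          Finset.sum_le_sum fun b _ => mul_le_mul_left (hlow b) _
      _ = ∑ b, n b • (ENNReal.ofReal ρ * ENNReal.ofReal c ^ p * V b (e ⊔ a) * v) :=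
          Finset.sum_congr rfl fun b _ => by rw [nsmul_eq_mul]; ring
      _ = ∑ R ∈ T, ENNReal.ofReal ρ * ENNReal.ofReal c ^ p * V (lab R) (e ⊔ a) * v :=
          (sum_label_eq T lab fun b => ENNReal.ofReal ρ * ENNReal.ofReal c ^ p * V b (e ⊔ a) * v).symm
      _ ≤ ∑ R ∈ T, ∫⁻ x in R.toSet, ‖e' ⊔ latticeMaximal 𝒮' G x‖ₑ ^ p := by
          refine Finset.sum_le_sum fun R hR => ?_
          have := hmax R (e ⊔ a) w c (he.trans le_sup_left) hc (hcρ.trans hρ₀ρ) hw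
          rw [hvolR R hR] at this
          refine this.trans (setLIntegral_mono' R.measurableSet_toSet fun x hx => ?_)
          refine ENNReal.rpow_le_rpow (enorm_mono_of_nonneg ?_ (hloc R hR x hx)) hp0.le
          exact (latticeMaximal_nonneg _ (hF0 R) x).trans le_sup_right
      _ = ∫⁻ x in ⋃ R ∈ T, R.toSet, ‖e' ⊔ latticeMaximal 𝒮' G x‖ₑ ^ p :=
          (lintegral_biUnion_finset (fun R hR R' hR' hne => hdisj (hT hR) (hT hR') hne)
            (fun R _ => R.measurableSet_toSet) _).symm
      _ ≤ ∫⁻ x in P.toSet, ‖e' ⊔ latticeMaximal 𝒮' G x‖ₑ ^ p :=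
          lintegral_mono_set (Set.iUnion₂_subset hTP)

end Realizable

/-! ### The maximal operator for a general measure -/

section Transference

variable {d : ℕ} {E : Type*} [NormedAddCommGroup E] [NormedSpace ℝ E] [Lattice E]
  [HasSolidNorm E] [IsOrderedAddMonoid E] [IsOrderedModule ℝ E] [CompleteSpace E]

/-- Jensen's inequality for the `p`-th power of the norm of an average. -/
theorem enorm_setAverage_rpow_le {X : Type*} [MeasurableSpace X] {μ : Measure X} {A : Set X}
    (hA : μ A ≠ 0) (hA' : μ A ≠ ∞) {f : X → E} (hf : AEStronglyMeasurable f μ) {p : ℝ}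
    (hp : 1 ≤ p) : ‖⨍ x in A, f x ∂μ‖ₑ ^ p ≤ ⨍⁻ x in A, ‖f x‖ₑ ^ p ∂μ := by
  have hp0 : 0 < p := by linarith
  have : IsProbabilityMeasure ((μ.restrict A Set.univ)⁻¹ • μ.restrict A) :=
    ⟨by simp [ENNReal.inv_mul_cancel hA hA']⟩
  set ν := (μ.restrict A Set.univ)⁻¹ • μ.restrict A
  have hν : AEStronglyMeasurable f ν := (hf.restrict).smul_measure _
  have h₁ : ‖∫ x, f x ∂ν‖ₑ ≤ eLpNorm f (ENNReal.ofReal p) ν :=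
    (enorm_integral_le_lintegral_enorm f).trans (by
      rw [← eLpNorm_one_eq_lintegral_enorm]
      exact eLpNorm_le_eLpNorm_of_exponent_le (by simpa using hp) hν)
  rw [eLpNorm_eq_lintegral_rpow_enorm_toReal (by simpa using hp0) ENNReal.ofReal_ne_top,
    ENNReal.toReal_ofReal hp0.le] at h₁
  calc ‖∫ x, f x ∂ν‖ₑ ^ p ≤ ((∫⁻ x, ‖f x‖ₑ ^ p ∂ν) ^ (1 / p)) ^ p :=
        ENNReal.rpow_le_rpow h₁ hp0.le
    _ = ∫⁻ x, ‖f x‖ₑ ^ p ∂ν := by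
        rw [← ENNReal.rpow_mul, one_div_mul_cancel hp0.ne', ENNReal.rpow_one]

/-- The cubes are adjoined from the small ones to the large ones; a cube `Q` that is adjoined last
splits the top set `A` into `Q` and `A \ Q`. -/
theorem realizable_cubes (hd : 0 < d) {p : ℝ} (hp : 1 ≤ p) (μ : Measure (Fin d → ℝ))
    {f : (Fin d → ℝ) → E} (hf : MemLp f (ENNReal.ofReal p) μ) (hf0 : 0 ≤ f)
    (𝒯 : Finset (DyadicCube d)) (hpos : ∀ Q ∈ 𝒯, μ Q.toSet ≠ 0) :
    ∀ A : Set (Fin d → ℝ), MeasurableSet A → μ A ≠ 0 → μ A ≠ ∞ →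
      (∀ Q ∈ 𝒯, Q.toSet ⊆ A ∨ Disjoint Q.toSet A) →
      Realizable d p (⨍ x in A, f x ∂μ) (⨍⁻ x in A, ‖f x‖ₑ ^ p ∂μ) fun e =>
        ⨍⁻ x in A, ‖e ⊔ (⨍ x in A, f x ∂μ) ⊔
          posSup 𝒯 (fun Q => Q.toSet.indicator (fun _ => ⨍ y in Q.toSet, f y ∂μ) x)‖ₑ ^ p ∂μ := by
  classical
  have hp0 : 0 ≤ p := by linarith
  have havg : ∀ A : Set (Fin d → ℝ), 0 ≤ ⨍ x in A, f x ∂μ := fun A => average_nonneg hf0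
  induction 𝒯 using Finset.induction_on_min_value (f := fun Q : DyadicCube d => Q.scale) with
  | empty =>
    intro A hA hA0 hA1 _
    refine (realizable_const hp (havg A)).mono (enorm_setAverage_rpow_le hA0 hA1 hf.1 hp)
      fun e he => le_of_eq ?_
    simp only [posSup_empty, sup_of_le_left (le_sup_of_le_right (havg A))]
    rw [setLAverage_const hA0 hA1]
  | insert Q 𝒯 hQ hmin ih =>
    intro A hA hA0 hA1 hlam
    have ih' := ih fun R hR => hpos R (Finset.mem_insert_of_mem hR)
    have hlam' : ∀ R ∈ 𝒯, R.toSet ⊆ A ∨ Disjoint R.toSet A :=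
      fun R hR => hlam R (Finset.mem_insert_of_mem hR)
    have hQ0 := hpos Q (Finset.mem_insert_self _ _)
    rcases hlam Q (Finset.mem_insert_self _ _) with hQA | hQA
    swap
    · refine (ih' A hA hA0 hA1 hlam').mono le_rfl fun e he => le_of_eq ?_
      refine setLAverage_congr_fun hA fun x hx => ?_
      simp only [posSup_insert, Set.indicator_of_notMem (Set.disjoint_right.1 hQA hx),
        sup_of_le_right (posSup_nonneg 𝒯 _)]
    by_cases hdiff : μ (A \ Q.toSet) = 0
    · refine (ih' A hA hA0 hA1 hlam').mono le_rfl fun e he => ?_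
      have hae : Q.toSet =ᵐ[μ] A :=
        Filter.EventuallyLE.antisymm (LE.le.eventuallyLE hQA) (ae_le_set.2 hdiff)
      have hQavg : ⨍ x in Q.toSet, f x ∂μ = ⨍ x in A, f x ∂μ := setAverage_congr hae
      refine laverage_mono_ae (Filter.Eventually.of_forall fun x => ?_)
      refine ENNReal.rpow_le_rpow (enorm_mono_of_nonneg
        (le_sup_of_le_right (posSup_nonneg _ _)) ?_) hp0
      rw [posSup_insert, ← sup_assoc]
      refine sup_le_sup_right (sup_le le_rfl ?_) _
      refine (Set.indicator_le_self' (fun _ _ => havg _) x).trans ?_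
      rw [hQavg]
      exact le_sup_right
    have hQ1 : μ Q.toSet ≠ ∞ := ((measure_mono hQA).trans_lt hA1.lt_top).ne
    have hB1 : μ (A \ Q.toSet) ≠ ∞ := ((measure_mono Set.sdiff_subset).trans_lt hA1.lt_top).ne
    have hBm : MeasurableSet (A \ Q.toSet) := hA.diff Q.measurableSet_toSet
    have hQu : Q.toSet ∪ A \ Q.toSet = A := Set.union_sdiff_cancel hQA
    have hadd : μ Q.toSet + μ (A \ Q.toSet) = μ A := by
      rw [← measure_union Set.disjoint_sdiff_right hBm, hQu]
    have hr₁ := ih' Q.toSet Q.measurableSet_toSet hQ0 hQ1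
      fun R hR => DyadicCube.subset_or_disjoint (hmin R hR)
    have hr₂ := ih' (A \ Q.toSet) hBm hdiff hB1 fun R hR => by
      rcases DyadicCube.subset_or_disjoint (hmin R hR) with h | h
      · exact Or.inr (Set.disjoint_sdiff_right.mono_left h)
      · exact (hlam' R hR).imp (fun h' => Set.subset_sdiff.2 ⟨h', h⟩)
          fun h' => h'.mono_right Set.sdiff_subset
    -- The two pieces and their relative measures.
    set B : Bool → Set (Fin d → ℝ) := fun b => if b then Q.toSet else A \ Q.toSet with hB
    have hAreal : 0 < μ.real A := ENNReal.toReal_pos hA0 hA1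
    have hB0 : ∀ b, μ (B b) ≠ 0 := fun b => by cases b; exacts [hdiff, hQ0]
    have hBtop : ∀ b, μ (B b) ≠ ∞ := fun b => by cases b; exacts [hB1, hQ1]
    have haddr : μ.real Q.toSet + μ.real (A \ Q.toSet) = μ.real A := by
      rw [measureReal_def, measureReal_def, measureReal_def, ← ENNReal.toReal_add hQ1 hB1, hadd]
    have hmix := realizable_mix hd hp (t := fun b => μ.real (B b) / μ.real A)
      (u := fun b => ⨍ x in B b, f x ∂μ) (N := fun b => ⨍⁻ x in B b, ‖f x‖ₑ ^ p ∂μ)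
      (V := fun b e => ⨍⁻ x in B b, ‖e ⊔ (⨍ x in B b, f x ∂μ) ⊔
          posSup 𝒯 (fun Q => Q.toSet.indicator (fun _ => ⨍ y in Q.toSet, f y ∂μ) x)‖ₑ ^ p ∂μ)
      (fun b => div_pos (ENNReal.toReal_pos (hB0 b) (hBtop b)) hAreal)
      (by
        rw [Fintype.sum_bool, ← add_div]
        simp only [hB, if_true, Bool.false_eq_true, if_false]
        rw [haddr, div_self hAreal.ne'])
      (fun b => havg _) (fun b => by cases b; exacts [hr₂, hr₁])
    have hu : ∑ b, (μ.real (B b) / μ.real A) • ⨍ x in B b, f x ∂μ = ⨍ x in A, f x ∂μ := by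
      have hint : ∀ s, μ s ≠ ∞ → IntegrableOn f s μ := fun s hs => by
        have : IsFiniteMeasure (μ.restrict s) := ⟨by simpa using hs.lt_top⟩
        exact (hf.restrict s).integrable (by simpa using hp)
      have := average_union (f := f) (Set.disjoint_sdiff_right (s := Q.toSet) (t := A)).aedisjoint
        hBm.nullMeasurableSet hQ1 hB1 (hint _ hQ1) (hint _ hB1)
      rw [hQu, haddr] at this
      rw [this, Fintype.sum_bool]
      rfl
    have ht : ∀ b, ENNReal.ofReal (μ.real (B b) / μ.real A) = μ (B b) / μ A := fun b => by
      rw [ENNReal.ofReal_div_of_pos hAreal, ofReal_measureReal (hBtop b), ofReal_measureReal hA1]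
    have hL : ∀ g : (Fin d → ℝ) → ℝ≥0∞,
        ∑ b, ENNReal.ofReal (μ.real (B b) / μ.real A) * ⨍⁻ x in B b, g x ∂μ
          = ⨍⁻ x in A, g x ∂μ := fun g => by
      have := laverage_union (f := g) (Set.disjoint_sdiff_right (s := Q.toSet) (t := A)).aedisjoint
        hBm.nullMeasurableSet (μ := μ)
      rw [hQu, hadd] at this
      rw [this, Fintype.sum_bool, ht, ht]
      rfl
    rw [hu, hL] at hmix
    refine hmix.mono le_rfl fun e he => ?_
    rw [← hL]
    refine Finset.sum_le_sum fun b _ => mul_le_mul_right ?_ _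
    have hBb : MeasurableSet (B b) := by cases b; exacts [hBm, Q.measurableSet_toSet]
    rw [setLAverage_eq, setLAverage_eq]
    refine ENNReal.div_le_div_right (setLIntegral_mono' hBb fun x hx => ?_) _
    refine ENNReal.rpow_le_rpow (enorm_mono_of_nonneg
      (le_sup_of_le_right (posSup_nonneg _ _)) ?_) hp0
    rw [posSup_insert, ← sup_assoc]
    refine sup_le_sup_right (sup_le le_sup_left ?_) _
    cases b
    · rw [Set.indicator_of_notMem hx.2]
      exact le_sup_of_le_right (havg _)
    · rw [Set.indicator_of_mem (show x ∈ Q.toSet from hx)]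
      exact le_sup_right

/-- A bound for the Lebesgue maximal operators is inherited by realizable triples. -/
theorem Realizable.le_rpow_mul {p : ℝ} (hp : 1 ≤ p) {u : E} {N : ℝ≥0∞} {V : E → ℝ≥0∞}
    (h : Realizable d p u N V) {K : ℝ≥0∞}
    (hK : ∀ (𝒟 : Finset (DyadicCube d)) (f : (Fin d → ℝ) → E), MemLp f (ENNReal.ofReal p) volume →
      eLpNorm (latticeMaximal 𝒟 f) (ENNReal.ofReal p) volume
        ≤ K * eLpNorm f (ENNReal.ofReal p) volume) : V 0 ≤ K ^ p * N := by
  have hp0 : 0 < p := by linarith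
  set P : DyadicCube d := ⟨0, 0⟩
  have hρ : ∀ ρ ∈ Set.Ioo (0 : ℝ) 1, ENNReal.ofReal ρ * ENNReal.ofReal ρ ^ p * V 0 ≤ K ^ p * N := by
    rintro ρ ⟨hρ, hρ1⟩
    obtain ⟨𝒮, F, -, -, hF, hF0, -, -, hmom, hmax⟩ := h ρ hρ hρ1 P
    have h₁ := hmax 0 0 ρ le_rfl hρ le_rfl (by simp)
    have h₂ := ENNReal.rpow_le_rpow (hK 𝒮 F hF) hp0.le
    rw [ENNReal.mul_rpow_of_nonneg _ _ hp0.le,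
      eLpNorm_eq_lintegral_rpow_enorm_toReal (by simpa using hp0) ENNReal.ofReal_ne_top,
      eLpNorm_eq_lintegral_rpow_enorm_toReal (by simpa using hp0) ENNReal.ofReal_ne_top,
      ENNReal.toReal_ofReal hp0.le, ← ENNReal.rpow_mul, ← ENNReal.rpow_mul,
      one_div_mul_cancel hp0.ne', ENNReal.rpow_one, ENNReal.rpow_one] at h₂
    have h₃ : ENNReal.ofReal ρ * ENNReal.ofReal ρ ^ p * V 0 * volume P.toSet
        ≤ K ^ p * N * volume P.toSet :=
      calc _ ≤ ∫⁻ x in P.toSet, ‖0 ⊔ latticeMaximal 𝒮 F x‖ₑ ^ p := h₁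
        _ ≤ ∫⁻ x, ‖0 ⊔ latticeMaximal 𝒮 F x‖ₑ ^ p := setLIntegral_le_lintegral _ _
        _ = ∫⁻ x, ‖latticeMaximal 𝒮 F x‖ₑ ^ p := by
            simp only [sup_of_le_right (latticeMaximal_nonneg 𝒮 hF0 _)]
        _ ≤ K ^ p * ∫⁻ x, ‖F x‖ₑ ^ p := h₂
        _ ≤ K ^ p * N * volume P.toSet := by
            rw [mul_assoc]
            exact mul_le_mul_right hmom _
    exact (ENNReal.mul_le_mul_iff_left P.volume_toSet_ne_zero P.volume_toSet_ne_top).1 h₃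
  -- Let `ρ` tend to `1`.
  have hlim : Filter.Tendsto (fun ρ : ℝ => ENNReal.ofReal ρ * ENNReal.ofReal ρ ^ p * V 0)
      (nhdsWithin 1 (Set.Iio 1)) (nhds (1 * V 0)) := by
    refine ENNReal.Tendsto.mul_const ?_ (Or.inl one_ne_zero)
    have hc : Filter.Tendsto (fun ρ : ℝ => ENNReal.ofReal (ρ * ρ ^ p)) (nhds 1)
        (nhds (ENNReal.ofReal (1 * 1 ^ p))) :=
      ENNReal.tendsto_ofReal (Filter.Tendsto.mul Filter.tendsto_id
        ((Real.continuousAt_rpow_const 1 p (Or.inl one_ne_zero)).tendsto))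
    rw [Real.one_rpow, mul_one, ENNReal.ofReal_one] at hc
    refine (hc.mono_left nhdsWithin_le_nhds).congr' ?_
    filter_upwards [Ioo_mem_nhdsLT (zero_lt_one' ℝ)] with ρ hρ
    rw [ENNReal.ofReal_mul hρ.1.le, ENNReal.ofReal_rpow_of_pos hρ.1]
  rw [one_mul] at hlim
  refine le_of_tendsto hlim ?_
  filter_upwards [Ioo_mem_nhdsLT (zero_lt_one' ℝ)] with ρ hρ'
  exact hρ ρ hρ'

open Classical in
/-- The lattice supremum of the averages of `f` over the members of `𝒟` that contain `Q`. -/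
noncomputable def runningSup (𝒟 : Finset (DyadicCube d)) (μ : Measure (Fin d → ℝ))
    (f : (Fin d → ℝ) → E) (Q : DyadicCube d) : E :=
  posSup (𝒟.filter fun R => Q.toSet ⊆ R.toSet) fun R => ⨍ y in R.toSet, f y ∂μ

theorem runningSup_nonneg (𝒟 : Finset (DyadicCube d)) (μ : Measure (Fin d → ℝ))
    (f : (Fin d → ℝ) → E) (Q : DyadicCube d) : 0 ≤ runningSup 𝒟 μ f Q :=
  posSup_nonneg _ _

/-- The lattice maximal operator of an arbitrary measure is bounded by the one of Lebesgue measure,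
with the same constant. -/
theorem lintegral_maxOver_runningSup_le (hd : 0 < d) {p : ℝ} (hp : 1 ≤ p) (μ : Measure (Fin d → ℝ))
    {f : (Fin d → ℝ) → E} (hf : MemLp f (ENNReal.ofReal p) μ) (hf0 : 0 ≤ f)
    {𝒟 : Finset (DyadicCube d)} (hpos : ∀ Q ∈ 𝒟, μ Q.toSet ≠ 0) (hfin : ∀ Q ∈ 𝒟, μ Q.toSet ≠ ∞)
    {K : ℝ≥0∞}
    (hK : ∀ (𝒟 : Finset (DyadicCube d)) (f : (Fin d → ℝ) → E), MemLp f (ENNReal.ofReal p) volume →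
      eLpNorm (latticeMaximal 𝒟 f) (ENNReal.ofReal p) volume
        ≤ K * eLpNorm f (ENNReal.ofReal p) volume) :
    ∫⁻ x, (maxOver 𝒟 DyadicCube.toSet (fun Q => ‖runningSup 𝒟 μ f Q‖₊) x : ℝ≥0∞) ^ p ∂μ
      ≤ K ^ p * ∫⁻ x, ‖f x‖ₑ ^ p ∂μ := by
  classical
  have hp0 : 0 < p := by linarith
  set h := maxOver 𝒟 DyadicCube.toSet fun Q => ‖runningSup 𝒟 μ f Q‖₊
  set A : Set (Fin d → ℝ) := ⋃ Q ∈ 𝒟, Q.toSet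
  have hAm : MeasurableSet A := Finset.measurableSet_biUnion _ fun Q _ => Q.measurableSet_toSet
  have hA1 : μ A ≠ ∞ := (measure_biUnion_lt_top 𝒟.finite_toSet fun Q hQ => (hfin Q hQ).lt_top).ne
  have hsub : ∀ Q ∈ 𝒟, Q.toSet ⊆ A := fun Q hQ =>
    Set.subset_biUnion_of_mem (u := fun Q => Q.toSet) (Finset.mem_coe.2 hQ)
  have hzero : ∀ x ∉ A, h x = 0 := fun x hx => by
    refine le_antisymm (Finset.sup_le fun Q hQ => ?_) zero_le
    obtain ⟨hQ, hxQ⟩ := Finset.mem_filter.1 hQ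
    exact absurd (hsub Q hQ hxQ) hx
  rcases 𝒟.eq_empty_or_nonempty with hne | ⟨Q₀, hQ₀⟩
  · have : ∀ x, h x = 0 := fun x => hzero x (by simp [A, hne])
    simp [this, hp0]
  have hA0 : μ A ≠ 0 := fun h0 => hpos Q₀ hQ₀ (measure_mono_null (hsub Q₀ hQ₀) h0)
  have hbound := (realizable_cubes hd hp μ hf hf0 𝒟 hpos A hAm hA0 hA1
    fun Q hQ => Or.inl (hsub Q hQ)).le_rpow_mul hp hK
  rw [setLAverage_eq, setLAverage_eq, ← mul_div_assoc,
    ENNReal.div_le_iff hA0 hA1, ENNReal.div_mul_cancel hA0 hA1] at hbound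
  calc ∫⁻ x, (h x : ℝ≥0∞) ^ p ∂μ = ∫⁻ x in A, (h x : ℝ≥0∞) ^ p ∂μ := by
        rw [← lintegral_indicator hAm]
        congr 1
        funext x
        by_cases hx : x ∈ A
        · rw [Set.indicator_of_mem hx]
        · rw [Set.indicator_of_notMem hx, hzero x hx, ENNReal.coe_zero, ENNReal.zero_rpow_of_pos hp0]
    _ ≤ _ := by
        refine lintegral_mono fun x => ENNReal.rpow_le_rpow ?_ hp0.le
        have : h x ≤ ‖(0 : E) ⊔ (⨍ x in A, f x ∂μ) ⊔ posSup 𝒟 (fun Q =>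
            Q.toSet.indicator (fun _ => ⨍ y in Q.toSet, f y ∂μ) x)‖₊ := by
          refine Finset.sup_le fun Q hQ => ?_
          obtain ⟨hQ, hxQ⟩ := Finset.mem_filter.1 hQ
          rw [← ENNReal.coe_le_coe, ← enorm_eq_nnnorm, ← enorm_eq_nnnorm]
          refine enorm_mono_of_nonneg (runningSup_nonneg _ _ _ _) (le_sup_of_le_right ?_)
          refine posSup_le (posSup_nonneg _ _) fun R hR => ?_
          obtain ⟨hR, hQR⟩ := Finset.mem_filter.1 hR
          refine le_trans (le_of_eq ?_) (le_posSup _ hR)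
          rw [Set.indicator_of_mem (hQR hxQ)]
        rw [enorm_eq_nnnorm]
        exact_mod_cast this
    _ ≤ K ^ p * ∫⁻ x in A, ‖f x‖ₑ ^ p ∂μ := hbound
    _ ≤ K ^ p * ∫⁻ x, ‖f x‖ₑ ^ p ∂μ := mul_le_mul_right (setLIntegral_le_lintegral _ _) _

end Transference

/-! ### Bounded truncations of the maximal function -/

section Truncation

variable {d : ℕ} {E : Type*} [NormedAddCommGroup E] [NormedSpace ℝ E] [Lattice E]
  [HasSolidNorm E] [IsOrderedAddMonoid E] [IsOrderedModule ℝ E] [CompleteSpace E]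
  {𝒟 : Finset (DyadicCube d)} {μ : Measure (Fin d → ℝ)} {f : (Fin d → ℝ) → E}

open Classical in
/-- The lattice supremum of the averages of `f` over those cubes `Q ∋ x` in `𝒟` at which the norm of
the running supremum is at most `t`. -/
noncomputable def truncatedSup (𝒟 : Finset (DyadicCube d)) (μ : Measure (Fin d → ℝ))
    (f : (Fin d → ℝ) → E) (t : ℝ≥0) : SimpleFunc (Fin d → ℝ) E :=
  (pattern 𝒟 DyadicCube.toSet fun Q _ => Q.measurableSet_toSet).map fun s =>
    posSup (s.filter fun Q => ‖runningSup 𝒟 μ f Q‖₊ ≤ t) fun Q => ⨍ y in Q.toSet, f y ∂μ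

open Classical in
theorem truncatedSup_apply (t : ℝ≥0) (x : Fin d → ℝ) : truncatedSup 𝒟 μ f t x
    = posSup ((𝒟.filter fun Q => x ∈ Q.toSet).filter fun Q => ‖runningSup 𝒟 μ f Q‖₊ ≤ t)
        fun Q => ⨍ y in Q.toSet, f y ∂μ := rfl

theorem truncatedSup_nonneg (t : ℝ≥0) (x : Fin d → ℝ) : 0 ≤ truncatedSup 𝒟 μ f t x :=
  posSup_nonneg _ _

/-- At each point the truncated supremum is dominated by the running supremum at the smallest of the
admissible cubes. -/
theorem nnnorm_truncatedSup_le (t : ℝ≥0) (x : Fin d → ℝ) : ‖truncatedSup 𝒟 μ f t x‖₊ ≤ t := by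
  classical
  rw [truncatedSup_apply]
  set 𝒮 := (𝒟.filter fun Q => x ∈ Q.toSet).filter fun Q => ‖runningSup 𝒟 μ f Q‖₊ ≤ t
  have h𝒮 : ∀ Q ∈ 𝒮, Q ∈ 𝒟 ∧ x ∈ Q.toSet ∧ ‖runningSup 𝒟 μ f Q‖₊ ≤ t := fun Q hQ => by
    simpa [𝒮, and_assoc] using hQ
  rcases 𝒮.eq_empty_or_nonempty with hne | hne
  · rw [hne, posSup_empty, nnnorm_zero]
    exact zero_le
  obtain ⟨Q, hQ, hmax⟩ := 𝒮.exists_max_image DyadicCube.scale hne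
  obtain ⟨-, hxQ, hQt⟩ := h𝒮 Q hQ
  refine le_trans ?_ hQt
  rw [← ENNReal.coe_le_coe, ← enorm_eq_nnnorm, ← enorm_eq_nnnorm]
  refine enorm_mono_of_nonneg (posSup_nonneg _ _) (posSup_le (runningSup_nonneg _ _ _ _) ?_)
  intro R hR
  obtain ⟨hR𝒟, hxR, -⟩ := h𝒮 R hR
  have hQR : Q.toSet ⊆ R.toSet := (DyadicCube.subset_or_disjoint (hmax R hR)).resolve_right
    (Set.not_disjoint_iff.2 ⟨x, hxQ, hxR⟩)
  exact le_posSup (fun R : DyadicCube d => ⨍ y in R.toSet, f y ∂μ)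
    (Finset.mem_filter.2 ⟨hR𝒟, hQR⟩)

theorem memLp_top_truncatedSup (t : ℝ≥0) (ν : Measure (Fin d → ℝ)) :
    MemLp (truncatedSup 𝒟 μ f t) ∞ ν :=
  (truncatedSup 𝒟 μ f t).memLp_top ν

theorem eLpNorm_truncatedSup_le (t : ℝ≥0) (ν : Measure (Fin d → ℝ)) :
    eLpNorm (truncatedSup 𝒟 μ f t) ∞ ν ≤ t := by
  rw [eLpNorm_exponent_top]
  exact eLpNormEssSup_le_of_ae_nnnorm_bound
    (Filter.Eventually.of_forall fun x => nnnorm_truncatedSup_le t x)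

theorem integrableOn_truncatedSup [IsLocallyFiniteMeasure μ] (t : ℝ≥0) (Q : DyadicCube d) :
    IntegrableOn (truncatedSup 𝒟 μ f t) Q.toSet μ := by
  have : IsFiniteMeasure (μ.restrict Q.toSet) :=
    ⟨by simpa using (Q.measure_toSet_ne_top μ).lt_top⟩
  exact (memLp_top_truncatedSup t _).integrable le_top

theorem setIntegral_le_setIntegral_truncatedSup [IsLocallyFiniteMeasure μ] {t : ℝ≥0}
    {Q : DyadicCube d} (hQ : Q ∈ 𝒟) (ht : ‖runningSup 𝒟 μ f Q‖₊ ≤ t) :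
    ∫ x in Q.toSet, f x ∂μ ≤ ∫ x in Q.toSet, truncatedSup 𝒟 μ f t x ∂μ := by
  classical
  have hfin := Q.measure_toSet_ne_top μ
  rw [← measure_smul_setAverage f hfin, ← setIntegral_const]
  refine setIntegral_mono_on (integrableOn_const hfin) (integrableOn_truncatedSup t Q)
    Q.measurableSet_toSet fun x hx => ?_
  exact le_posSup (fun R : DyadicCube d => ⨍ y in R.toSet, f y ∂μ)
    (Finset.mem_filter.2 ⟨Finset.mem_filter.2 ⟨hQ, hx⟩, ht⟩)

theorem setIntegral_truncatedSup_nonneg (t : ℝ≥0) (Q : DyadicCube d) :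
    0 ≤ ∫ x in Q.toSet, truncatedSup 𝒟 μ f t x ∂μ :=
  integral_nonneg fun x => truncatedSup_nonneg t x

end Truncation

/-! ### The dyadic operator and its bilinear form -/

section Operator

variable {d : ℕ} {C D : Type*} [NormedAddCommGroup C] [NormedSpace ℝ C]
  [NormedAddCommGroup D] [NormedSpace ℝ D]
  {𝒟 : Finset (DyadicCube d)} {lam : DyadicCube d → C →ₗ[ℝ] D} {σ ω : Measure (Fin d → ℝ)}

theorem mem_subcubes {R Q : DyadicCube d} :
    Q ∈ subcubes 𝒟 R ↔ Q ∈ 𝒟 ∧ Q.toSet ⊆ R.toSet := by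
  classical
  simp [subcubes]

theorem integrableOn_of_memLp [IsLocallyFiniteMeasure σ] {p : ℝ} (hp : 1 ≤ p)
    {f : (Fin d → ℝ) → C} (hf : MemLp f (ENNReal.ofReal p) σ) (Q : DyadicCube d) :
    IntegrableOn f Q.toSet σ := by
  have : IsFiniteMeasure (σ.restrict Q.toSet) :=
    ⟨by simpa using (Q.measure_toSet_ne_top σ).lt_top⟩
  exact (hf.restrict _).integrable (by simpa using hp)

theorem dyadicOp_eq_zero_of_notMem {R : DyadicCube d} (f : (Fin d → ℝ) → C) {x : Fin d → ℝ}
    (hx : x ∉ R.toSet) : dyadicOp (subcubes 𝒟 R) lam σ f x = 0 :=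
  Finset.sum_eq_zero fun _ hQ =>
    Set.indicator_of_notMem (fun hxQ => hx ((mem_subcubes.1 hQ).2 hxQ)) _

theorem memLp_dyadicOp [IsLocallyFiniteMeasure ω] (f : (Fin d → ℝ) → C) (r : ℝ≥0∞) :
    MemLp (dyadicOp 𝒟 lam σ f) r ω :=
  memLp_finsetSum _ fun Q _ => memLp_indicator_const _ Q.measurableSet_toSet _
    (Or.inr (Q.measure_toSet_ne_top ω))

theorem apply_dyadicOp (f : (Fin d → ℝ) → C) (g : (Fin d → ℝ) → StrongDual ℝ D) (x : Fin d → ℝ) :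
    g x (dyadicOp 𝒟 lam σ f x)
      = ∑ Q ∈ 𝒟, Q.toSet.indicator (fun x => g x (lam Q (∫ y in Q.toSet, f y ∂σ))) x := by
  rw [dyadicOp, map_sum]
  refine Finset.sum_congr rfl fun Q _ => ?_
  by_cases hx : x ∈ Q.toSet <;> simp [hx]

theorem integrable_indicator_apply {g : (Fin d → ℝ) → StrongDual ℝ D} {Q : DyadicCube d}
    (hg : IntegrableOn g Q.toSet ω) (v : D) :
    Integrable (Q.toSet.indicator fun x => g x v) ω :=
  IntegrableOn.integrable_indicator (hg.apply_continuousLinearMap v) Q.measurableSet_toSet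

theorem integrable_pairing (f : (Fin d → ℝ) → C) {g : (Fin d → ℝ) → StrongDual ℝ D}
    (hg : ∀ Q ∈ 𝒟, IntegrableOn g Q.toSet ω) :
    Integrable (fun x => g x (dyadicOp 𝒟 lam σ f x)) ω := by
  simp only [apply_dyadicOp]
  exact integrable_finsetSum _ fun Q hQ => integrable_indicator_apply (hg Q hQ) _

/-- The bilinear form of the dyadic operator depends only on the integrals over the cubes. -/
theorem integral_pairing (f : (Fin d → ℝ) → C) {g : (Fin d → ℝ) → StrongDual ℝ D}
    (hg : ∀ Q ∈ 𝒟, IntegrableOn g Q.toSet ω) :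
    ∫ x, g x (dyadicOp 𝒟 lam σ f x) ∂ω
      = ∑ Q ∈ 𝒟, (∫ x in Q.toSet, g x ∂ω) (lam Q (∫ y in Q.toSet, f y ∂σ)) := by
  simp only [apply_dyadicOp]
  rw [integral_finsetSum _ fun Q hQ => integrable_indicator_apply (hg Q hQ) _]
  refine Finset.sum_congr rfl fun Q hQ => ?_
  rw [integral_indicator Q.measurableSet_toSet, ContinuousLinearMap.integral_apply (hg Q hQ)]

variable [Lattice C] [IsOrderedAddMonoid C] [IsOrderedModule ℝ C] [HasSolidNorm C]
  [Lattice D] [IsOrderedAddMonoid D] [IsOrderedModule ℝ D] [HasSolidNorm D]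

theorem abs_map_le_map_abs {T : C →ₗ[ℝ] D} (hT : ∀ c : C, 0 ≤ c → 0 ≤ T c) {a b : C}
    (h : |a| ≤ b) : |T a| ≤ T b := by
  obtain ⟨h₁, h₂⟩ := abs_le'.1 h
  have h₃ := hT _ (sub_nonneg.2 h₁)
  have h₄ := hT _ (sub_nonneg.2 h₂)
  rw [map_sub, sub_nonneg] at h₃ h₄
  rw [map_neg] at h₄
  exact abs_le'.2 ⟨h₃, h₄⟩

theorem abs_setIntegral_le [CompleteSpace C] {f : (Fin d → ℝ) → C} {s : Set (Fin d → ℝ)}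
    (hf : IntegrableOn f s σ) : |∫ x in s, f x ∂σ| ≤ ∫ x in s, |f x| ∂σ := by
  have habs : IntegrableOn (fun x => |f x|) s σ := hf.abs
  refine abs_le'.2 ⟨integral_mono hf habs fun x => le_abs_self _, ?_⟩
  rw [← integral_neg]
  exact integral_mono hf.neg habs fun x => neg_le_abs _

theorem abs_sum_le {ι : Type*} (s : Finset ι) (v : ι → D) : |∑ i ∈ s, v i| ≤ ∑ i ∈ s, |v i| := by
  refine abs_le'.2 ⟨Finset.sum_le_sum fun i _ => le_abs_self _, ?_⟩
  rw [← Finset.sum_neg_distrib]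
  exact Finset.sum_le_sum fun i _ => neg_le_abs _

/-- Domination for the localized operator: `f` and `F` are compared only on the cube `R`. -/
theorem abs_dyadicOp_le [CompleteSpace C] {𝒟' : Finset (DyadicCube d)} (h𝒟 : 𝒟' ⊆ 𝒟)
    (hlam : ∀ Q ∈ 𝒟, ∀ c : C, 0 ≤ c → 0 ≤ lam Q c) {f F : (Fin d → ℝ) → C}
    (hf : ∀ Q ∈ 𝒟', IntegrableOn f Q.toSet σ) (hF : 0 ≤ F)
    (hfF : ∀ Q ∈ 𝒟', ∀ x ∈ Q.toSet, |f x| = F x) (x : Fin d → ℝ) :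
    |dyadicOp 𝒟' lam σ f x| ≤ dyadicOp 𝒟 lam σ F x := by
  have hpos : ∀ Q ∈ 𝒟, 0 ≤ Q.toSet.indicator (fun _ => lam Q (∫ y in Q.toSet, F y ∂σ)) x :=
    fun Q hQ => Set.indicator_nonneg (fun _ _ => hlam Q hQ _ (integral_nonneg hF)) x
  calc |dyadicOp 𝒟' lam σ f x|
      ≤ ∑ Q ∈ 𝒟', |Q.toSet.indicator (fun _ => lam Q (∫ y in Q.toSet, f y ∂σ)) x| :=
        abs_sum_le _ _
    _ ≤ ∑ Q ∈ 𝒟', Q.toSet.indicator (fun _ => lam Q (∫ y in Q.toSet, F y ∂σ)) x := by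
        refine Finset.sum_le_sum fun Q hQ => ?_
        by_cases hx : x ∈ Q.toSet
        · rw [Set.indicator_of_mem hx, Set.indicator_of_mem hx]
          refine abs_map_le_map_abs (hlam Q (h𝒟 hQ)) ((abs_setIntegral_le (hf Q hQ)).trans ?_)
          rw [setIntegral_congr_fun Q.measurableSet_toSet (hfF Q hQ)]
        · rw [Set.indicator_of_notMem hx, Set.indicator_of_notMem hx, abs_zero]
    _ ≤ dyadicOp 𝒟 lam σ F x :=
        Finset.sum_le_sum_of_subset_of_nonneg h𝒟 fun Q hQ _ => hpos Q hQ

theorem dyadicOp_nonneg [CompleteSpace C] (hlam : ∀ Q ∈ 𝒟, ∀ c : C, 0 ≤ c → 0 ≤ lam Q c)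
    {f : (Fin d → ℝ) → C} (hf : 0 ≤ f) (x : Fin d → ℝ) : 0 ≤ dyadicOp 𝒟 lam σ f x :=
  Finset.sum_nonneg fun Q hQ =>
    Set.indicator_nonneg (fun _ _ => hlam Q hQ _ (integral_nonneg hf)) x

end Operator

/-! ### The best constants are attained -/

/-- The least constant in a family of inequalities `a i ≤ K * b i` is itself admissible.  The first
hypothesis is needed because the least constant may be `∞`, while `∞ * 0 = 0`. -/
theorem le_sInf_mul {ι : Type*} (P : ι → Prop) (a b : ι → ℝ≥0∞) (h0 : ∀ i, P i → b i = 0 → a i = 0)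
    (htop : ∀ i, P i → b i ≠ ∞) {i : ι} (hi : P i) :
    a i ≤ sInf {K : ℝ≥0∞ | ∀ i, P i → a i ≤ K * b i} * b i := by
  by_cases hb : b i = 0
  · simp [h0 i hi hb]
  · rw [← ENNReal.div_le_iff hb (htop i hi)]
    exact le_sInf fun K hK => (ENNReal.div_le_iff hb (htop i hi)).2 (hK i hi)

theorem eLpNorm_latticeMaximal_le {d : ℕ} {E : Type*} [NormedAddCommGroup E] [NormedSpace ℝ E]
    [Lattice E] {p : ℝ} (hp : 0 < p) (𝒟 : Finset (DyadicCube d)) (f : (Fin d → ℝ) → E)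
    (hf : MemLp f (ENNReal.ofReal p) volume) :
    eLpNorm (latticeMaximal 𝒟 f) (ENNReal.ofReal p) volume
      ≤ maximalNorm d E p * eLpNorm f (ENNReal.ofReal p) volume := by
  have h := le_sInf_mul
    (fun i : Finset (DyadicCube d) × ((Fin d → ℝ) → E) => MemLp i.2 (ENNReal.ofReal p) volume)
    (fun i => eLpNorm (latticeMaximal i.1 i.2) (ENNReal.ofReal p) volume)
    (fun i => eLpNorm i.2 (ENNReal.ofReal p) volume) ?_ (fun i hi => hi.2.ne) (i := (𝒟, f)) hf
  · simpa only [maximalNorm, Prod.forall] using h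
  · rintro ⟨𝒟, f⟩ hf h0
    have hae : f =ᵐ[volume] 0 := (eLpNorm_eq_zero_iff hf.1 (by simpa using hp)).1 h0
    have havg : ∀ Q : DyadicCube d, ⨍ y in Q.toSet, f y = 0 := fun Q => by
      rw [average_congr (ae_restrict_of_ae hae)]
      simp
    have : latticeMaximal 𝒟 f = 0 := by
      funext x
      rw [latticeMaximal]
      split_ifs with hne
      · simp only [havg, Set.indicator_zero, Finset.sup'_const, Pi.zero_apply]
      · rfl
    simp only [this, eLpNorm_zero]

/-! ### Bounds by the testing constant -/

section Main

variable {d : ℕ} {C D : Type*} [NormedAddCommGroup C] [NormedSpace ℝ C]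
  [NormedAddCommGroup D] [NormedSpace ℝ D]
  {𝒟 : Finset (DyadicCube d)} {lam : DyadicCube d → C →ₗ[ℝ] D} {σ ω : Measure (Fin d → ℝ)}

/-- The testing inequality holds with the testing constant itself. -/
theorem ofReal_integral_pairing_le [IsLocallyFiniteMeasure σ] [IsLocallyFiniteMeasure ω] {p q : ℝ}
    (hp : 1 < p) (hq : 1 < q) {R : DyadicCube d} (hR : R ∈ 𝒟) {f : (Fin d → ℝ) → C}
    {g : (Fin d → ℝ) → StrongDual ℝ D} (hf : MemLp f ∞ (σ.restrict R.toSet))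
    (hg : MemLp g ∞ (ω.restrict R.toSet)) :
    ENNReal.ofReal (∫ x, g x (dyadicOp (subcubes 𝒟 R) lam σ f x) ∂ω)
      ≤ dualPairingTestingConst p q 𝒟 lam σ ω * (eLpNorm f ∞ (σ.restrict R.toSet)
        * eLpNorm g ∞ (ω.restrict R.toSet)
        * σ R.toSet ^ (1 / p) * ω R.toSet ^ (1 / q.conjExponent)) := by
  have hr := (Real.HolderConjugate.conjExponent hq).symm.pos
  have hp0 : 0 < p := by linarith
  have h := le_sInf_mul
    (fun i : DyadicCube d × ((Fin d → ℝ) → C) × ((Fin d → ℝ) → StrongDual ℝ D) =>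
      i.1 ∈ 𝒟 ∧ MemLp i.2.1 ∞ (σ.restrict i.1.toSet) ∧ MemLp i.2.2 ∞ (ω.restrict i.1.toSet))
    (fun i => ENNReal.ofReal (∫ x, i.2.2 x (dyadicOp (subcubes 𝒟 i.1) lam σ i.2.1 x) ∂ω))
    (fun i => eLpNorm i.2.1 ∞ (σ.restrict i.1.toSet)
        * eLpNorm i.2.2 ∞ (ω.restrict i.1.toSet)
        * σ i.1.toSet ^ (1 / p) * ω i.1.toSet ^ (1 / q.conjExponent)) ?_ ?_ (i := (R, f, g))
    ⟨hR, hf, hg⟩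
  · refine h.trans (mul_le_mul_left (sInf_le_sInf fun B hB => ?_) _)
    rintro ⟨R, f, g⟩ ⟨hR, hf, hg⟩
    exact (hB R hR f g hf hg).trans_eq (by ring)
  · rintro ⟨R, f, g⟩ ⟨-, hf, hg⟩ h0
    simp only at hf hg h0 ⊢
    -- If the right-hand side vanishes then so does one of the functions on the cube.
    have hcase : f =ᵐ[σ.restrict R.toSet] 0 ∨ g =ᵐ[ω.restrict R.toSet] 0 := by
      rw [mul_eq_zero, mul_eq_zero, mul_eq_zero, eLpNorm_eq_zero_iff hf.1 (by simp),
        eLpNorm_eq_zero_iff hg.1 (by simp), ENNReal.rpow_eq_zero_iff_of_pos (by positivity),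
        ENNReal.rpow_eq_zero_iff_of_pos (by positivity)] at h0
      rcases h0 with ((h0 | h0) | h0) | h0
      · exact Or.inl h0
      · exact Or.inr h0
      · left
        rw [Measure.restrict_eq_zero.2 h0, Filter.EventuallyEq, ae_zero]
        exact Filter.eventually_bot
      · right
        rw [Measure.restrict_eq_zero.2 h0, Filter.EventuallyEq, ae_zero]
        exact Filter.eventually_bot
    rcases hcase with h0 | h0
    · have hop : ∀ x, dyadicOp (subcubes 𝒟 R) lam σ f x = 0 := fun x => by
        refine Finset.sum_eq_zero fun Q hQ => ?_
        rw [integral_eq_zero_of_ae (ae_restrict_of_ae_restrict_of_subset (mem_subcubes.1 hQ).2 h0),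
          map_zero, Set.indicator_zero]
      simp [hop]
    · have : (fun x => g x (dyadicOp (subcubes 𝒟 R) lam σ f x)) =ᵐ[ω] 0 := by
        filter_upwards [(ae_restrict_iff' R.measurableSet_toSet).1 h0] with x hx
        by_cases hxR : x ∈ R.toSet
        · simp [hx hxR]
        · simp [dyadicOp_eq_zero_of_notMem f hxR]
      rw [integral_eq_zero_of_ae this, ENNReal.ofReal_zero]
  · rintro ⟨R, f, g⟩ ⟨-, hf, hg⟩
    exact ENNReal.mul_ne_top (ENNReal.mul_ne_top (ENNReal.mul_ne_top hf.2.ne hg.2.ne)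
      (ENNReal.rpow_ne_top_of_nonneg (by positivity) (R.measure_toSet_ne_top σ)))
      (ENNReal.rpow_ne_top_of_nonneg (by positivity) (R.measure_toSet_ne_top ω))

theorem lintegral_iSup_le_aInfty {𝒟' : Finset (DyadicCube d)} (h : 𝒟' ⊆ 𝒟) {R : DyadicCube d}
    (hR : R ∈ 𝒟') (h0 : σ R.toSet ≠ 0) (h1 : σ R.toSet ≠ ∞) [DecidablePred fun Q : DyadicCube d =>
      Q.toSet ⊆ R.toSet] :
    ∫⁻ x, ⨆ Q ∈ 𝒟'.filter fun Q => Q.toSet ⊆ R.toSet,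
      Q.toSet.indicator (fun _ => σ Q.toSet / ω Q.toSet) x ∂ω ≤ aInfty 𝒟 σ ω * σ R.toSet := by
  rw [← ENNReal.div_le_iff h0 h1]
  refine le_trans (ENNReal.div_le_div_right (lintegral_mono fun x => ?_) _)
    (le_iSup₂ (f := fun R (_ : R ∈ 𝒟) => (∫⁻ x, localMaximal 𝒟 R σ ω x ∂ω) / σ R.toSet) R (h hR))
  refine iSup₂_le fun Q hQ => ?_
  obtain ⟨hQ, hQR⟩ := Finset.mem_filter.1 hQ
  exact le_iSup₂ (f := fun Q (_ : Q ∈ subcubes 𝒟 R) =>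
    Q.toSet.indicator (fun _ => σ Q.toSet / ω Q.toSet) x) Q (mem_subcubes.2 ⟨h hQ, hQR⟩)

variable [CompleteSpace C] [Lattice C] [IsOrderedAddMonoid C] [IsOrderedModule ℝ C] [HasSolidNorm C]
  [CompleteSpace D] [Lattice D] [IsOrderedAddMonoid D] [IsOrderedModule ℝ D] [HasSolidNorm D]
  [IsLocallyFiniteMeasure σ] [IsLocallyFiniteMeasure ω]

theorem rpow_lintegral_maxOver_le {E : Type*} [NormedAddCommGroup E] [NormedSpace ℝ E] [Lattice E]
    [HasSolidNorm E] [IsOrderedAddMonoid E] [IsOrderedModule ℝ E] [CompleteSpace E] (hd : 0 < d)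
    {p : ℝ} (hp : 1 < p) {f : (Fin d → ℝ) → E} (hf : MemLp f (ENNReal.ofReal p) σ) (hf0 : 0 ≤ f)
    (hpos : ∀ Q ∈ 𝒟, σ Q.toSet ≠ 0) :
    (∫⁻ x, (maxOver 𝒟 DyadicCube.toSet (fun Q => ‖runningSup 𝒟 σ f Q‖₊) x : ℝ≥0∞) ^ p ∂σ) ^ (1 / p)
      ≤ maximalNorm d E p * eLpNorm f (ENNReal.ofReal p) σ := by
  have hp0 : 0 < p := by linarith
  have h := lintegral_maxOver_runningSup_le hd hp.le σ hf hf0 hpos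
    (fun Q _ => Q.measure_toSet_ne_top σ) (eLpNorm_latticeMaximal_le hp0)
  refine (ENNReal.rpow_le_rpow h (by positivity : 0 ≤ 1 / p)).trans (le_of_eq ?_)
  rw [ENNReal.mul_rpow_of_nonneg _ _ (by positivity : 0 ≤ 1 / p), ← ENNReal.rpow_mul,
    mul_one_div_cancel hp0.ne', ENNReal.rpow_one,
    eLpNorm_eq_lintegral_rpow_enorm_toReal (by simpa using hp0) ENNReal.ofReal_ne_top,
    ENNReal.toReal_ofReal hp0.le]

/-- The bound for the bilinear form.  On a piece in which the running suprema of `f` and `g` are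
bounded by `u` and `v`, the functions may be replaced by truncated suprema, to which the testing
condition applies. -/
theorem ofReal_integral_pairing_le_of_nonneg (hd : 0 < d) {p q : ℝ} (hp : 1 < p) (hpq : p ≤ q)
    (hlam : ∀ Q ∈ 𝒟, ∀ c : C, 0 ≤ c → 0 ≤ lam Q c) {f : (Fin d → ℝ) → C}
    (hf : MemLp f (ENNReal.ofReal p) σ) (hf0 : 0 ≤ f) {g : (Fin d → ℝ) → StrongDual ℝ D}
    (hg : MemLp g (ENNReal.ofReal q.conjExponent) ω) (hg0 : 0 ≤ g) :
    ENNReal.ofReal (∫ x, g x (dyadicOp 𝒟 lam σ f x) ∂ω)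
      ≤ 128 * dualPairingTestingConst p q 𝒟 lam σ ω
        * (aInfty 𝒟 σ ω ^ (1 / p) + aInfty 𝒟 ω σ ^ (1 / q.conjExponent))
        * (maximalNorm d C p * eLpNorm f (ENNReal.ofReal p) σ)
        * (maximalNorm d (StrongDual ℝ D) q.conjExponent
            * eLpNorm g (ENNReal.ofReal q.conjExponent) ω) := by
  classical
  have hq : 1 < q := hp.trans_le hpq
  have hqc := Real.HolderConjugate.conjExponent hq
  set r := q.conjExponent
  have hr : 1 < r := hqc.symm.lt
  have hpr : 1 ≤ 1 / p + 1 / r := by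
    have h₁ := hqc.inv_add_inv_eq_one
    have h₂ := one_div_le_one_div_of_le (by linarith : 0 < p) hpq
    rw [← one_div, ← one_div] at h₁
    linarith
  set B := dualPairingTestingConst p q 𝒟 lam σ ω
  -- Cubes that are null for `σ` or for `ω` contribute nothing to the form.
  set 𝒟' := 𝒟.filter fun Q => σ Q.toSet ≠ 0 ∧ ω Q.toSet ≠ 0
  have hsub : 𝒟' ⊆ 𝒟 := Finset.filter_subset _ _
  have hσ : ∀ Q ∈ 𝒟', σ Q.toSet ≠ 0 := fun Q hQ => (Finset.mem_filter.1 hQ).2.1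
  have hω : ∀ Q ∈ 𝒟', ω Q.toSet ≠ 0 := fun Q hQ => (Finset.mem_filter.1 hQ).2.2
  set a : DyadicCube d → ℝ≥0∞ := fun Q =>
    ENNReal.ofReal ((∫ x in Q.toSet, g x ∂ω) (lam Q (∫ y in Q.toSet, f y ∂σ)))
  have hgint : ∀ Q : DyadicCube d, 0 ≤ ∫ x in Q.toSet, g x ∂ω := fun Q => integral_nonneg hg0
  have hfint : ∀ Q : DyadicCube d, 0 ≤ ∫ y in Q.toSet, f y ∂σ := fun Q => integral_nonneg hf0
  have hform : ENNReal.ofReal (∫ x, g x (dyadicOp 𝒟 lam σ f x) ∂ω) = ∑ Q ∈ 𝒟', a Q := by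
    rw [integral_pairing f fun Q _ => integrableOn_of_memLp hr.le hg Q,
      ENNReal.ofReal_sum_of_nonneg fun Q hQ => hgint Q _ (hlam Q hQ _ (hfint Q))]
    refine (Finset.sum_subset hsub fun Q hQ hQ' => ?_).symm
    have h0 : σ Q.toSet = 0 ∨ ω Q.toSet = 0 := by
      by_contra hcon
      push Not at hcon
      exact hQ' (Finset.mem_filter.2 ⟨hQ, hcon⟩)
    rcases h0 with h0 | h0
    · simp [Measure.restrict_eq_zero.2 h0]
    · simp [Measure.restrict_eq_zero.2 h0]
  have hlocal : ∀ R ∈ 𝒟', ∀ u v : ℝ≥0, ∑ Q ∈ 𝒟' with Q.toSet ⊆ R.toSet ∧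
      ‖runningSup 𝒟' σ f Q‖₊ ≤ u ∧ ‖runningSup 𝒟' ω g Q‖₊ ≤ v, a Q
      ≤ B * u * v * σ R.toSet ^ (1 / p) * ω R.toSet ^ (1 / r) := by
    intro R hR u v
    set F := truncatedSup 𝒟' σ f u
    set G := truncatedSup 𝒟' ω g v
    have hFint : ∀ Q : DyadicCube d, 0 ≤ ∫ x in Q.toSet, F x ∂σ :=
      setIntegral_truncatedSup_nonneg u
    have hGint : ∀ Q : DyadicCube d, 0 ≤ ∫ x in Q.toSet, G x ∂ω :=
      setIntegral_truncatedSup_nonneg v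
    have h𝒟 : ∀ Q ∈ subcubes 𝒟 R, Q ∈ 𝒟 := fun Q hQ => (mem_subcubes.1 hQ).1
    calc _ ≤ ∑ Q ∈ 𝒟' with Q.toSet ⊆ R.toSet ∧ ‖runningSup 𝒟' σ f Q‖₊ ≤ u ∧
            ‖runningSup 𝒟' ω g Q‖₊ ≤ v,
            ENNReal.ofReal ((∫ x in Q.toSet, G x ∂ω) (lam Q (∫ y in Q.toSet, F y ∂σ))) := by
          refine Finset.sum_le_sum fun Q hQ => ENNReal.ofReal_le_ofReal ?_
          obtain ⟨hQ, -, hQu, hQv⟩ := Finset.mem_filter.1 hQ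
          have hlamQ := hlam Q (hsub hQ)
          have h₁ := setIntegral_le_setIntegral_truncatedSup hQ hQu
          have h₂ := setIntegral_le_setIntegral_truncatedSup hQ hQv
          have h₃ : lam Q (∫ y in Q.toSet, f y ∂σ) ≤ lam Q (∫ y in Q.toSet, F y ∂σ) := by
            rw [← sub_nonneg, ← map_sub]
            exact hlamQ _ (sub_nonneg.2 h₁)
          have h₄ := hgint Q _ (sub_nonneg.2 h₃)
          rw [zero_apply, map_sub, sub_nonneg] at h₄
          exact h₄.trans (h₂ _ (hlamQ _ (hFint Q)))
      _ ≤ ∑ Q ∈ subcubes 𝒟 R,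
            ENNReal.ofReal ((∫ x in Q.toSet, G x ∂ω) (lam Q (∫ y in Q.toSet, F y ∂σ))) := by
          refine Finset.sum_le_sum_of_subset fun Q hQ => ?_
          obtain ⟨hQ, hQR, -⟩ := Finset.mem_filter.1 hQ
          exact mem_subcubes.2 ⟨hsub hQ, hQR⟩
      _ = ENNReal.ofReal (∫ x, G x (dyadicOp (subcubes 𝒟 R) lam σ F x) ∂ω) := by
          rw [integral_pairing F fun Q _ => integrableOn_truncatedSup v Q,
            ENNReal.ofReal_sum_of_nonneg fun Q hQ =>
              hGint Q _ (hlam Q (h𝒟 Q hQ) _ (hFint Q))]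
      _ ≤ B * (eLpNorm F ∞ (σ.restrict R.toSet) * eLpNorm G ∞ (ω.restrict R.toSet)
            * σ R.toSet ^ (1 / p) * ω R.toSet ^ (1 / r)) :=
          ofReal_integral_pairing_le hp hq (hsub hR) (memLp_top_truncatedSup u _)
            (memLp_top_truncatedSup v _)
      _ ≤ B * (u * v * σ R.toSet ^ (1 / p) * ω R.toSet ^ (1 / r)) := by
          refine mul_le_mul_right (mul_le_mul_left (mul_le_mul_left (mul_le_mul' ?_ ?_) _) _) _
          · exact eLpNorm_truncatedSup_le u _
          · exact eLpNorm_truncatedSup_le v _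
      _ = B * u * v * σ R.toSet ^ (1 / p) * ω R.toSet ^ (1 / r) := by ring
  rw [hform]
  refine (sum_le_of_local_bound (DyadicCube.isLaminar hd 𝒟') hσ
    (fun Q _ => Q.measure_toSet_ne_top σ) hω (fun Q _ => Q.measure_toSet_ne_top ω) hp hr hpr
    (A₁ := aInfty 𝒟 σ ω) (A₂ := aInfty 𝒟 ω σ)
    (fun R hR => lintegral_iSup_le_aInfty hsub hR (hσ R hR) (R.measure_toSet_ne_top σ))
    (fun R hR => lintegral_iSup_le_aInfty hsub hR (hω R hR) (R.measure_toSet_ne_top ω))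
    hlocal).trans ?_
  exact mul_le_mul' (mul_le_mul_right (rpow_lintegral_maxOver_le hd hp hf hf0 hσ) _)
    (rpow_lintegral_maxOver_le hd hr hg hg0 hω)

/-- The norm of a finitely valued nonnegative function is attained by pairing with a finitely valued
nonnegative function. -/
theorem eLpNorm_dyadicOp_le_of_pairing {q : ℝ} (hq : 1 < q)
    (hlam : ∀ Q ∈ 𝒟, ∀ c : C, 0 ≤ c → 0 ≤ lam Q c) {f : (Fin d → ℝ) → C} (hf0 : 0 ≤ f)
    {N : ℝ≥0∞} (hN : ∀ g : (Fin d → ℝ) → StrongDual ℝ D,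
      MemLp g (ENNReal.ofReal q.conjExponent) ω → 0 ≤ g →
      ENNReal.ofReal (∫ x, g x (dyadicOp 𝒟 lam σ f x) ∂ω)
        ≤ N * eLpNorm g (ENNReal.ofReal q.conjExponent) ω) :
    eLpNorm (dyadicOp 𝒟 lam σ f) (ENNReal.ofReal q) ω ≤ N := by
  classical
  have hq0 : 0 < q := by linarith
  have hqc := Real.HolderConjugate.conjExponent hq
  set r := q.conjExponent
  have hr0 : 0 < r := hqc.symm.pos
  set y : (Fin d → ℝ) → D := dyadicOp 𝒟 lam σ f with hy
  have hy0 : ∀ x, 0 ≤ y x := dyadicOp_nonneg hlam hf0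
  have hex : ∀ v : D, ∃ φ : StrongDual ℝ D, 0 ≤ φ ∧ ‖φ‖ ≤ 1 ∧ (0 ≤ v → ‖v‖ ≤ φ v) := fun v => by
    by_cases hv : 0 ≤ v
    · obtain ⟨φ, h₁, h₂, h₃⟩ := exists_nonneg_dual_vector hv
      exact ⟨φ, h₁, h₂, fun _ => h₃⟩
    · exact ⟨0, le_rfl, by simp, fun h => absurd h hv⟩
  choose φ hφ0 hφ1 hφ using hex
  set Y : SimpleFunc (Fin d → ℝ) D :=
    (pattern 𝒟 DyadicCube.toSet fun Q _ => Q.measurableSet_toSet).map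
      fun s => ∑ Q ∈ s, lam Q (∫ y in Q.toSet, f y ∂σ)
  have hyY : ∀ x, y x = Y x := fun x => by
    change ∑ Q ∈ 𝒟, _ = ∑ Q ∈ 𝒟 with x ∈ Q.toSet, _
    rw [Finset.sum_filter]
    exact Finset.sum_congr rfl fun Q _ => by simp [Set.indicator_apply]
  set g : SimpleFunc (Fin d → ℝ) (StrongDual ℝ D) := Y.map fun v => ‖v‖ ^ (q - 1) • φ v
  have hg : ∀ x, g x = ‖y x‖ ^ (q - 1) • φ (y x) := fun x => by rw [hyY]; rfl
  set X := ∫⁻ x, ‖y x‖ₑ ^ q ∂ω with hX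
  have hnorm : eLpNorm y (ENNReal.ofReal q) ω = X ^ (1 / q) := by
    rw [eLpNorm_eq_lintegral_rpow_enorm_toReal (by simpa using hq0) ENNReal.ofReal_ne_top,
      ENNReal.toReal_ofReal hq0.le]
  have hXtop : X ≠ ∞ := by
    have := (memLp_dyadicOp (𝒟 := 𝒟) (lam := lam) (σ := σ) (ω := ω) f (ENNReal.ofReal q)).2
    rw [← hy, hnorm, ENNReal.rpow_lt_top_iff_of_pos (by positivity)] at this
    exact this.ne
  have hgnorm : eLpNorm g (ENNReal.ofReal r) ω ≤ X ^ (1 / r) := by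
    rw [eLpNorm_eq_lintegral_rpow_enorm_toReal (by simpa using hr0) ENNReal.ofReal_ne_top,
      ENNReal.toReal_ofReal hr0.le]
    refine ENNReal.rpow_le_rpow (lintegral_mono fun x => ?_) (by positivity)
    rw [hg, enorm_smul]
    calc (‖‖y x‖ ^ (q - 1)‖ₑ * ‖φ (y x)‖ₑ) ^ r ≤ (‖y x‖ₑ ^ (q - 1) * 1) ^ r := by
          refine ENNReal.rpow_le_rpow (mul_le_mul' (le_of_eq ?_) ?_) hr0.le
          · rw [Real.enorm_of_nonneg (by positivity), ← ENNReal.ofReal_rpow_of_nonneg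
              (norm_nonneg _) (by linarith), ofReal_norm]
          · rw [← ofReal_norm]
            exact ENNReal.ofReal_le_one.2 (hφ1 _)
      _ = ‖y x‖ₑ ^ q := by
          rw [mul_one, ← ENNReal.rpow_mul, hqc.sub_one_mul_conj]
  have hgmem : MemLp g (ENNReal.ofReal r) ω :=
    ⟨g.aestronglyMeasurable, hgnorm.trans_lt
      (ENNReal.rpow_lt_top_of_nonneg (by positivity) hXtop)⟩
  have hg0 : (0 : (Fin d → ℝ) → StrongDual ℝ D) ≤ g := fun x => by
    rw [hg]
    exact smul_nonneg (by positivity) (hφ0 _)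
  have hpair : ∀ x, ‖y x‖ ^ q ≤ g x (y x) := fun x => by
    rw [hg, smul_apply, smul_eq_mul]
    calc ‖y x‖ ^ q = ‖y x‖ ^ (q - 1) * ‖y x‖ := by
          rcases (norm_nonneg (y x)).eq_or_lt with h0 | h0
          · rw [← h0, mul_zero, Real.zero_rpow hq0.ne']
          · rw [← Real.rpow_add_one h0.ne', sub_add_cancel]
      _ ≤ _ := mul_le_mul_of_nonneg_left (hφ _ (hy0 x)) (by positivity)
  have hXle : X ≤ ENNReal.ofReal (∫ x, g x (y x) ∂ω) := by
    have hint : Integrable (fun x => g x (y x)) ω :=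
      integrable_pairing f fun Q _ => integrableOn_of_memLp hqc.symm.lt.le hgmem Q
    rw [ofReal_integral_eq_lintegral_ofReal hint (Filter.Eventually.of_forall fun x =>
      (by positivity : (0 : ℝ) ≤ ‖y x‖ ^ q).trans (hpair x))]
    refine lintegral_mono fun x => ?_
    rw [← ofReal_norm, ENNReal.ofReal_rpow_of_nonneg (norm_nonneg _) hq0.le]
    exact ENNReal.ofReal_le_ofReal (hpair x)
  have hfinal : X ≤ N * X ^ (1 / r) :=
    hXle.trans ((hN g hgmem hg0).trans (mul_le_mul_right hgnorm _))
  rw [hnorm]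
  by_cases hX0 : X = 0
  · rw [hX0, ENNReal.zero_rpow_of_pos (by positivity)]
    exact zero_le
  have hsplit : X = X ^ (1 / q) * X ^ (1 / r) := by
    rw [← ENNReal.rpow_add _ _ hX0 hXtop, hqc.one_div_add_one_div, div_one, ENNReal.rpow_one]
  have hpos : X ^ (1 / r) ≠ 0 := by
    rw [Ne, ENNReal.rpow_eq_zero_iff_of_pos (by positivity)]
    exact hX0
  have htop : X ^ (1 / r) ≠ ∞ := ENNReal.rpow_ne_top_of_nonneg (by positivity) hXtop
  conv_lhs at hfinal => rw [hsplit]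
  exact (ENNReal.mul_le_mul_iff_left hpos htop).1 hfinal

theorem dyadicOpNorm_le (hd : 0 < d) {p q : ℝ} (hp : 1 < p) (hpq : p ≤ q)
    (hlam : ∀ Q ∈ 𝒟, ∀ c : C, 0 ≤ c → 0 ≤ lam Q c) :
    dyadicOpNorm p q 𝒟 lam σ ω ≤
      128 * maximalNorm d C p * maximalNorm d (StrongDual ℝ D) q.conjExponent
        * (aInfty 𝒟 σ ω ^ (1 / p) + aInfty 𝒟 ω σ ^ (1 / q.conjExponent))
        * dualPairingTestingConst p q 𝒟 lam σ ω := by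
  refine sInf_le fun f hf => ?_
  have habs : MemLp (fun x => |f x|) (ENNReal.ofReal p) σ := hf.abs
  have hnorm : eLpNorm (fun x => |f x|) (ENNReal.ofReal p) σ = eLpNorm f (ENNReal.ofReal p) σ :=
    eLpNorm_congr_norm_ae (Filter.Eventually.of_forall fun x => norm_abs_eq_norm _)
  have habs0 : (0 : (Fin d → ℝ) → C) ≤ fun x => |f x| := fun x => abs_nonneg _
  calc eLpNorm (dyadicOp 𝒟 lam σ f) (ENNReal.ofReal q) ω
      ≤ eLpNorm (dyadicOp 𝒟 lam σ fun x => |f x|) (ENNReal.ofReal q) ω := by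
        refine eLpNorm_mono fun x => norm_le_norm_of_abs_le_abs ?_
        rw [abs_of_nonneg (dyadicOp_nonneg hlam habs0 x)]
        exact abs_dyadicOp_le subset_rfl hlam (fun Q _ => integrableOn_of_memLp hp.le hf Q) habs0
          (fun _ _ _ _ => rfl) x
    _ ≤ _ := by
        refine eLpNorm_dyadicOp_le_of_pairing (hp.trans_le hpq) hlam habs0 fun g hg hg0 => ?_
        refine (ofReal_integral_pairing_le_of_nonneg hd hp hpq hlam habs habs0 hg hg0).trans
          (le_of_eq ?_)
        rw [hnorm]
        ring

/-- Testing is weaker than the norm inequality: on `R` the localized operator is dominated by the full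
one applied to `|f| 1_R`, and Hölder's inequality applies. -/
theorem dualPairingTestingConst_le {p q : ℝ} (hp : 1 < p) (hpq : p ≤ q)
    (hlam : ∀ Q ∈ 𝒟, ∀ c : C, 0 ≤ c → 0 ≤ lam Q c) :
    dualPairingTestingConst p q 𝒟 lam σ ω ≤ dyadicOpNorm p q 𝒟 lam σ ω := by
  have hp0 : 0 < p := by linarith
  have hq : 1 < q := hp.trans_le hpq
  have hqc := Real.HolderConjugate.conjExponent hq
  refine le_sInf fun K hK => sInf_le fun R hR f g hf hg => ?_
  have hσR : IsFiniteMeasure (σ.restrict R.toSet) :=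
    ⟨by simpa using (R.measure_toSet_ne_top σ).lt_top⟩
  set F : (Fin d → ℝ) → C := R.toSet.indicator fun x => |f x|
  have hF0 : 0 ≤ F := Set.indicator_nonneg fun x _ => abs_nonneg _
  have hfp : MemLp (fun x => |f x|) (ENNReal.ofReal p) (σ.restrict R.toSet) :=
    (hf.mono_exponent le_top).abs
  have hFmem : MemLp F (ENNReal.ofReal p) σ :=
    (memLp_indicator_iff_restrict R.measurableSet_toSet).2 hfp
  have hFnorm : eLpNorm F (ENNReal.ofReal p) σ
      ≤ eLpNorm f ∞ (σ.restrict R.toSet) * σ R.toSet ^ (1 / p) := by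
    rw [eLpNorm_indicator_eq_eLpNorm_restrict R.measurableSet_toSet,
      eLpNorm_congr_norm_ae (Filter.Eventually.of_forall fun x => norm_abs_eq_norm (f x))]
    have := eLpNorm_le_eLpNorm_mul_rpow_measure_univ (p := ENNReal.ofReal p) le_top hf.1
    simpa [ENNReal.toReal_ofReal hp0.le] using this
  have hdom : ∀ x, ‖dyadicOp (subcubes 𝒟 R) lam σ f x‖ₑ ≤ ‖dyadicOp 𝒟 lam σ F x‖ₑ := by
    intro x
    refine enorm_le_iff_norm_le.2 (norm_le_norm_of_abs_le_abs ?_)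
    rw [abs_of_nonneg (dyadicOp_nonneg hlam hF0 x)]
    refine abs_dyadicOp_le (fun Q hQ => (mem_subcubes.1 hQ).1) hlam (fun Q hQ => ?_) hF0
      (fun Q hQ x hx => (Set.indicator_of_mem ((mem_subcubes.1 hQ).2 hx) fun x => |f x|).symm) x
    exact IntegrableOn.mono_set (hf.integrable le_top) (mem_subcubes.1 hQ).2
  have hT := memLp_dyadicOp (𝒟 := 𝒟) (lam := lam) (σ := σ) (ω := ω) F (ENNReal.ofReal q)
  have hT1 : ∫⁻ x in R.toSet, ‖dyadicOp 𝒟 lam σ F x‖ₑ ∂ω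
      ≤ eLpNorm (dyadicOp 𝒟 lam σ F) (ENNReal.ofReal q) ω
        * ω R.toSet ^ (1 / q.conjExponent) := by
    have h₁ := eLpNorm_le_eLpNorm_mul_rpow_measure_univ (p := 1) (q := ENNReal.ofReal q)
      (μ := ω.restrict R.toSet) (by simpa using hq.le) hT.1.restrict
    rw [eLpNorm_one_eq_lintegral_enorm, ENNReal.toReal_ofReal (by linarith)] at h₁
    have h₂ : 1 / (1 : ℝ≥0∞).toReal - 1 / q = 1 / q.conjExponent := by
      have := hqc.one_div_add_one_div
      simp only [ENNReal.toReal_one]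
      linarith
    rw [h₂, Measure.restrict_apply_univ] at h₁
    exact h₁.trans (mul_le_mul_left (eLpNorm_mono_measure _ Measure.restrict_le_self) _)
  calc ENNReal.ofReal (∫ x, g x (dyadicOp (subcubes 𝒟 R) lam σ f x) ∂ω)
      ≤ ∫⁻ x, ‖g x (dyadicOp (subcubes 𝒟 R) lam σ f x)‖ₑ ∂ω := by
        refine le_trans ?_ (enorm_integral_le_lintegral_enorm _)
        rw [← ofReal_norm]
        exact ENNReal.ofReal_le_ofReal (Real.le_norm_self _)
    _ = ∫⁻ x in R.toSet, ‖g x (dyadicOp (subcubes 𝒟 R) lam σ f x)‖ₑ ∂ω := by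
        rw [← lintegral_indicator R.measurableSet_toSet]
        congr 1
        funext x
        by_cases hx : x ∈ R.toSet
        · rw [Set.indicator_of_mem hx]
        · rw [Set.indicator_of_notMem hx, dyadicOp_eq_zero_of_notMem f hx, map_zero, enorm_zero]
    _ ≤ ∫⁻ x in R.toSet, eLpNorm g ∞ (ω.restrict R.toSet) * ‖dyadicOp 𝒟 lam σ F x‖ₑ ∂ω := by
        refine lintegral_mono_ae ?_
        rw [eLpNorm_exponent_top]
        filter_upwards [enorm_ae_le_eLpNormEssSup g (ω.restrict R.toSet)] with x hx
        exact ((g x).le_opENorm _).trans (mul_le_mul' hx (hdom x))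
    _ = eLpNorm g ∞ (ω.restrict R.toSet) * ∫⁻ x in R.toSet, ‖dyadicOp 𝒟 lam σ F x‖ₑ ∂ω :=
        lintegral_const_mul' _ _ hg.2.ne
    _ ≤ eLpNorm g ∞ (ω.restrict R.toSet) * (K * (eLpNorm f ∞ (σ.restrict R.toSet)
          * σ R.toSet ^ (1 / p)) * ω R.toSet ^ (1 / q.conjExponent)) := by
        refine mul_le_mul_right (hT1.trans (mul_le_mul_left ?_ _)) _
        exact (hK F hFmem).trans (mul_le_mul_right hFnorm _)
    _ = _ := by ring

end Main

end DyadicTesting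

open DyadicTesting in
theorem mainTheorem2 (p q : ℝ) (hp : 1 < p) (hpq : p ≤ q) :
    ∃ K : ℝ≥0, ∀ (d : ℕ) (_ : 0 < d)
      (C : Type*) [NormedAddCommGroup C] [NormedSpace ℝ C] [CompleteSpace C] [Lattice C]
      [IsOrderedAddMonoid C] [IsOrderedModule ℝ C] [HasSolidNorm C]
      (D : Type*) [NormedAddCommGroup D] [NormedSpace ℝ D] [CompleteSpace D] [Lattice D]
      [IsOrderedAddMonoid D] [IsOrderedModule ℝ D] [HasSolidNorm D]
      (_ : HardyLittlewoodProperty d C) (_ : HardyLittlewoodProperty d (StrongDual ℝ D))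
      (σ ω : Measure (Fin d → ℝ)) [IsLocallyFiniteMeasure σ] [IsLocallyFiniteMeasure ω]
      (𝒟 : Finset (DyadicCube d)) (lam : DyadicCube d → C →ₗ[ℝ] D)
      (_ : ∀ Q ∈ 𝒟, ∀ c : C, 0 ≤ c → 0 ≤ lam Q c)
      (_ : aInfty 𝒟 σ ω < ∞) (_ : aInfty 𝒟 ω σ < ∞),
      dualPairingTestingConst p q 𝒟 lam σ ω ≤ dyadicOpNorm p q 𝒟 lam σ ω ∧
      dyadicOpNorm p q 𝒟 lam σ ω ≤
        K * maximalNorm d C p * maximalNorm d (StrongDual ℝ D) q.conjExponent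
          * (aInfty 𝒟 σ ω ^ (1 / p) + aInfty 𝒟 ω σ ^ (1 / q.conjExponent))
          * dualPairingTestingConst p q 𝒟 lam σ ω := by
  refine ⟨128, fun d hd C _ _ _ _ _ _ _ D _ _ _ _ _ _ _ _ _ σ ω _ _ 𝒟 lam hlam _ _ => ?_⟩
  refine ⟨dualPairingTestingConst_le hp hpq hlam, ?_⟩
  exact dyadicOpNorm_le hd hp hpq hlam
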